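/- For an integer $m\ge 0$ let $\mathbb F_m$ be the Hirzebruch surface over $\mathbb C$, i.e. the quotient of $(\mathbb A^2\setminus\{0\})^2$ by $((x_0,x_1),(y_0,y_1))\sim((\mu x_0,\lambda^{-m}\mu x_1),(\lambda y_0,\lambda y_1))$, $\lambda,\mu\in\mathbb C^*$, with points written $[x_0:x_1;y_0:y_1]$. Let $S_+$ be the section $x_0=0$, let $\iota_m:\mathbb A^2\hookrightarrow\mathbb F_m$, $(x,y)\mapsto[x:1;y:1]$, and let $p=[0:1;1:0]$. A nonzero polynomial $F\in\mathbb C[x,y]$ is said to be of bidegree $(a,b)$ if its Newton polygon lies in the triangle spanned by $(a,0)$, $(0,0)$ and $(0,b)$. For $F$ of bidegree $(a,am)$, an $(a,am)$-divisor of $F$ is an effective divisor $C\sim aS_+$ on $\mathbb F_m$ whose restriction to $\iota_m(\mathbb A^2)\simeq\mathbb A^2$ is the divisor of zeros of $F$ (with multiplicities). Below, $m_p(C)$ denotes the multiplicity of $C$ at $p$ and $I_p(y_1,C)$ the local intersection number at $p$ of $C$ with the fiber $y_1=0$. **Lemma.** Let $a,m\ge1$ be integers. 1. Every nonzero polynomial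 $F\in\mathbb C[x,y]$ of bidegree $(a,am)$ has a unique $(a,am)$-divisor. 2. Let $C$ be an effective divisor on $\mathbb F_m$ with $C\sim aS_+$. Then there is a polynomial $F$ of bidegree $(a,am)$, unique up to multiplication by a nonzero constant, such that $C$ is the $(a,am)$-divisor of $F$. If $C$ is irreducible (a prime divisor), then $F$ is irreducible. Moreover, let $F$ be a polynomial of bidegree $(a,am)$ and $C$ its $(a,am)$-divisor. Then $C$ is the zero divisor of a polynomial $$G=\sum_{i=0}^a x_0^i\,x_1^{a-i}\,G_{m(a-i)}(y_0,y_1),$$ where $G_{m(a-i)}$ is homogeneous of degree $m(a-i)$ (or zero), and for each such $G$ and each integer $r$ with $0\le r<a$ the following are equivalent: (i) $F$ is of bidegree $(a,am-r)$; (ii) $y_1^{\,r-\lfloor ir/a\rfloor}$ divides $G_{m(a-i)}$ for all $i=0,\dots,a$. Furthermore: (A) If $a\ge2$, then (i) holds for $r=1$ if and only if $I_p(y_1,C)=a$ or $y_1=0$ is a component of $C$. (B) If $a=3$, then (i) holds for $r=2$ if and only if (a) $m_p(C)\ge3$, or (b) $m_p(C)=2$ and $C$ has only one tangent direction at $p$,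 namely the one given by $y_1=0$. If moreover $y_1=0$ is not a component of $C$, then condition (a) may be replaced by $m_p(C)=3$. -/

import Mathlib

open MvPolynomial

noncomputable section

namespace HirzebruchSurface

/-- The variables of the homogeneous coordinate ring: `Sum.inl i` is `x_i`, `Sum.inr j` is `y_j`. -/
abbrev Var : Type := Fin 2 ⊕ Fin 2

/-- The variety `(𝔸² ∖ {0})²` of points `((x₀, x₁), (y₀, y₁))`. -/
def Cone : Type := {v : Var → ℂ // (∃ i, v (Sum.inl i) ≠ 0) ∧ ∃ j, v (Sum.inr j) ≠ 0}

/-- The Zariski topology on `(𝔸² ∖ {0})²`, induced from the prime spectrum of the polynomial ring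
by sending a point to its maximal ideal. -/
instance : TopologicalSpace Cone :=
  TopologicalSpace.induced (fun v => pointToPoint (k := ℂ) v.1) inferInstance

/-- The equivalence relation
`((x₀, x₁), (y₀, y₁)) ~ ((μ x₀, λ⁻ᵐ μ x₁), (λ y₀, λ y₁))`, `λ, μ ∈ ℂ*`. -/
def coneSetoid (m : ℕ) : Setoid Cone where
  r v w := ∃ l μ : ℂ, l ≠ 0 ∧ μ ≠ 0 ∧
    v.1 (Sum.inl 0) = μ * w.1 (Sum.inl 0) ∧
    v.1 (Sum.inl 1) = (l ^ m)⁻¹ * μ * w.1 (Sum.inl 1) ∧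
    v.1 (Sum.inr 0) = l * w.1 (Sum.inr 0) ∧
    v.1 (Sum.inr 1) = l * w.1 (Sum.inr 1)
  iseqv :=
    { refl := fun v => ⟨1, 1, one_ne_zero, one_ne_zero, by simp, by simp, by simp, by simp⟩
      symm := by
        rintro v w ⟨l, μ, hl, hμ, h1, h2, h3, h4⟩
        refine ⟨l⁻¹, μ⁻¹, inv_ne_zero hl, inv_ne_zero hμ, ?_, ?_, ?_, ?_⟩
        · rw [h1]; field_simp
        · rw [h2, inv_pow]; field_simp
        · rw [h3]; field_simp
        · rw [h4]; field_simp
      trans := by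
        rintro u v w ⟨l, μ, hl, hμ, h1, h2, h3, h4⟩ ⟨l2, μ2, hl2, hμ2, k1, k2, k3, k4⟩
        refine ⟨l * l2, μ * μ2, mul_ne_zero hl hl2, mul_ne_zero hμ hμ2, ?_, ?_, ?_, ?_⟩
        · rw [h1, k1]; ring
        · rw [h2, k2, mul_pow, mul_inv]; ring
        · rw [h3, k3]; ring
        · rw [h4, k4]; ring }

/-- The `m`-th Hirzebruch surface `𝔽_m` (its set of closed points). -/
def Hirzebruch (m : ℕ) : Type := Quotient (coneSetoid m)

/-- The class `[x₀ : x₁ ; y₀ : y₁]`. -/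
def mk (m : ℕ) (v : Cone) : Hirzebruch m := Quotient.mk (coneSetoid m) v

/-- The Zariski topology on `𝔽_m`, as the quotient topology. -/
instance (m : ℕ) : TopologicalSpace (Hirzebruch m) :=
  TopologicalSpace.coinduced (mk m) inferInstance

/-- The standard affine chart `𝔸² → 𝔽_m` onto `{x_i ≠ 0, y_j ≠ 0}`: it puts `x_i = 1`, `y_j = 1`
and uses the point `q` for the other `x`-coordinate and the other `y`-coordinate.
For `i = j = 1` it is the embedding `(x, y) ↦ [x : 1 ; y : 1]`. -/
def chart (m : ℕ) (i j : Fin 2) (q : Fin 2 → ℂ) : Hirzebruch m :=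
  mk m ⟨Sum.elim (fun k => if k = i then 1 else q 0) (fun k => if k = j then 1 else q 1),
    ⟨i, by simp⟩, ⟨j, by simp⟩⟩

/-- Dehomogenization of a polynomial in `x₀, x₁, y₀, y₁` in the chart `(i, j)`. -/
def dehom (i j : Fin 2) : MvPolynomial Var ℂ →ₐ[ℂ] MvPolynomial (Fin 2) ℂ :=
  aeval (Sum.elim (fun k => if k = i then 1 else X 0) (fun k => if k = j then 1 else X 1))

/-- The weights giving the grading of the homogeneous coordinate ring of `𝔽_m`:
`deg x₀ = (1, 0)`, `deg x₁ = (1, -m)`, `deg y₀ = deg y₁ = (0, 1)`. -/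
def wt (m : ℕ) : Var → ℤ × ℤ :=
  Sum.elim ![(1, 0), (1, -(m : ℤ))] (fun _ => (0, 1))

/-- The nonzero homogeneous polynomials on `𝔽_m`. -/
def Form (m : ℕ) : Type :=
  {G : MvPolynomial Var ℂ // G ≠ 0 ∧ ∃ d : ℤ × ℤ, G.IsWeightedHomogeneous (wt m) d}

/-- A variable, as a form. -/
def Form.var (m : ℕ) (s : Var) : Form m :=
  ⟨X s, X_ne_zero s, wt m s, isWeightedHomogeneous_X ℂ (wt m) s⟩

/-- The zero set on `𝔽_m` of a form. -/
def Form.zeroSet {m : ℕ} (G : Form m) : Set (Hirzebruch m) :=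
  {P | ∃ v : Cone, mk m v = P ∧ eval v.1 G.1 = 0}

/-- Prime divisors on `𝔽_m`: irreducible closed subsets of codimension one. -/
def PrimeDivisor (m : ℕ) : Type :=
  {Z : TopologicalSpace.IrreducibleCloseds (Hirzebruch m) // Order.coheight Z = 1}

/-- The underlying set of points of a prime divisor. -/
def PrimeDivisor.pts {m : ℕ} (Z : PrimeDivisor m) : Set (Hirzebruch m) := (Z.1 : Set _)

/-- The ideal of a prime divisor `Z` in the chart `(i, j)`. It is the unit ideal if `Z` does not
meet the chart, and a principal prime ideal otherwise. -/
def PrimeDivisor.ideal {m : ℕ} (Z : PrimeDivisor m) (i j : Fin 2) :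
    Ideal (MvPolynomial (Fin 2) ℂ) :=
  vanishingIdeal ℂ (chart m i j ⁻¹' Z.pts)

/-- The order of `h` with respect to the powers of an ideal `I`. -/
def ordAt {A : Type*} [CommRing A] (I : Ideal A) (h : A) : ℕ∞ :=
  ⨆ (n : ℕ) (_ : h ∈ I ^ n), (n : ℕ∞)

/-- The order of vanishing of a form along a prime divisor `Z`, computed on charts. The charts
meeting `Z` all give the same finite value, the others give `⊤`; so the infimum is that value. -/
def Form.ord {m : ℕ} (G : Form m) (Z : PrimeDivisor m) : ℕ :=
  (⨅ (i : Fin 2) (j : Fin 2), ordAt (Z.ideal i j) (dehom i j G.1)).toNat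

/-- Weil divisors on `𝔽_m`. -/
abbrev Divisor (m : ℕ) : Type := PrimeDivisor m →₀ ℤ

/-! ### Finiteness of the support of the divisor of a form -/

lemma eval_scale (m : ℕ) {G : MvPolynomial Var ℂ} {d : ℤ × ℤ}
    (hG : G.IsWeightedHomogeneous (wt m) d) (l μ : ℂ) (hl : l ≠ 0) (hμ : μ ≠ 0) (w : Var → ℂ) :
    eval (fun s => μ ^ (wt m s).1 * l ^ (wt m s).2 * w s) G
      = μ ^ d.1 * l ^ d.2 * eval w G := by
  rw [eval_eq, eval_eq, Finset.mul_sum]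
  refine Finset.sum_congr rfl fun e he => ?_
  have hd := hG (mem_support_iff.mp he)
  rw [Finsupp.weight_apply, Finsupp.sum] at hd
  have key : ∀ T : Finset Var, ∏ s ∈ T, (μ ^ (wt m s).1 * l ^ (wt m s).2) ^ e s
      = μ ^ (∑ s ∈ T, e s • wt m s).1 * l ^ (∑ s ∈ T, e s • wt m s).2 := by
    intro T
    induction T using Finset.induction_on with
    | empty => simp
    | insert s T hs ih =>
      rw [Finset.prod_insert hs, Finset.sum_insert hs, ih]
      rw [Prod.fst_add, Prod.snd_add, Prod.smul_fst, Prod.smul_snd, zpow_add₀ hl, zpow_add₀ hμ,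
        nsmul_eq_mul, nsmul_eq_mul, mul_comm (e s : ℤ), mul_comm (e s : ℤ), zpow_mul, zpow_mul,
        zpow_natCast, zpow_natCast, mul_pow]
      ring
  have h2 : ∏ s ∈ e.support, (μ ^ (wt m s).1 * l ^ (wt m s).2 * w s) ^ e s
      = μ ^ d.1 * l ^ d.2 * ∏ s ∈ e.support, w s ^ e s := by
    rw [← hd, ← key e.support, ← Finset.prod_mul_distrib]
    exact Finset.prod_congr rfl fun s _ => mul_pow _ _ _
  rw [h2]
  ring

lemma eval_eq_zero_iff_of_rel (m : ℕ) (G : Form m) {v w : Cone} (h : mk m v = mk m w) :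
    eval v.1 G.1 = 0 ↔ eval w.1 G.1 = 0 := by
  obtain ⟨l, μ, hl, hμ, h1, h2, h3, h4⟩ := Quotient.exact h
  obtain ⟨d, hd⟩ := G.2.2
  have hv : v.1 = fun s => μ ^ (wt m s).1 * l ^ (wt m s).2 * w.1 s := by
    funext s
    rcases s with s | s <;> fin_cases s <;> simp [wt, h1, h2, h3, h4]
    exact Or.inl (mul_comm _ _)
  rw [hv, eval_scale m hd l μ hl hμ]
  simp [hl, hμ, zpow_ne_zero]

lemma isClosed_cone (G : MvPolynomial Var ℂ) : IsClosed {v : Cone | eval v.1 G = 0} := by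
  refine isClosed_induced_iff.mpr
    ⟨PrimeSpectrum.zeroLocus {G}, PrimeSpectrum.isClosed_zeroLocus _, ?_⟩
  ext v
  simp [pointToPoint, PrimeSpectrum.mem_zeroLocus, aeval_eq_eval]

lemma continuous_mk (m : ℕ) : Continuous (mk m) := continuous_coinduced_rng

lemma mk_surjective (m : ℕ) : Function.Surjective (mk m) := Quotient.mk_surjective

lemma Form.preimage_zeroSet {m : ℕ} (G : Form m) :
    mk m ⁻¹' G.zeroSet = {v : Cone | eval v.1 G.1 = 0} := by
  ext v
  constructor
  · rintro ⟨w, hw, h0⟩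
    exact (eval_eq_zero_iff_of_rel m G hw).1 h0
  · intro h
    exact ⟨v, rfl, h⟩

lemma Form.isClosed_zeroSet {m : ℕ} (G : Form m) : IsClosed G.zeroSet := by
  refine isClosed_coinduced.mpr ?_
  rw [G.preimage_zeroSet]
  exact isClosed_cone _

instance : TopologicalSpace.NoetherianSpace Cone :=
  Topology.IsInducing.noetherianSpace
    (i := fun v : Cone => pointToPoint (k := ℂ) v.1) ⟨rfl⟩

instance (m : ℕ) : TopologicalSpace.NoetherianSpace (Hirzebruch m) :=
  TopologicalSpace.noetherianSpace_of_surjective (mk m) (continuous_mk m) (mk_surjective m)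

/-- A nonzero polynomial does not vanish at some point of the cone. -/
lemma exists_cone_eval_ne {G : MvPolynomial Var ℂ} (hG : G ≠ 0) : ∃ v : Cone, eval v.1 G ≠ 0 := by
  have h : G * (X (Sum.inl 0) * X (Sum.inr 0)) ≠ 0 :=
    mul_ne_zero hG (mul_ne_zero (X_ne_zero _) (X_ne_zero _))
  by_contra! hc
  apply h
  refine MvPolynomial.funext fun v => ?_
  by_cases h1 : v (Sum.inl 0) = 0
  · simp [h1]
  by_cases h2 : v (Sum.inr 0) = 0
  · simp [h2]
  have := hc ⟨v, ⟨0, h1⟩, ⟨0, h2⟩⟩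
  simp [this]

lemma exists_basic_of_isOpen {U : Set Cone} (hU : IsOpen U) {v : Cone} (hv : v ∈ U) :
    ∃ G : MvPolynomial Var ℂ, G ≠ 0 ∧ ∀ w : Cone, eval w.1 G ≠ 0 → w ∈ U := by
  obtain ⟨O, hO, rfl⟩ := isOpen_induced_iff.mp hU
  obtain ⟨_, ⟨f, rfl⟩, hvf, hf⟩ :=
    PrimeSpectrum.isTopologicalBasis_basic_opens.exists_subset_of_mem_open hv hO
  refine ⟨f, ?_, fun w hw => hf ?_⟩
  · rintro rfl
    simp at hvf
  · simpa [pointToPoint, aeval_eq_eval] using hw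

instance : PreirreducibleSpace Cone where
  isPreirreducible_univ := by
    rintro U V hU hV ⟨u, -, hu⟩ ⟨v, -, hv⟩
    obtain ⟨G, hG, hGU⟩ := exists_basic_of_isOpen hU hu
    obtain ⟨H, hH, hHV⟩ := exists_basic_of_isOpen hV hv
    obtain ⟨w, hw⟩ := exists_cone_eval_ne (mul_ne_zero hG hH)
    rw [map_mul] at hw
    exact ⟨w, trivial, hGU w (left_ne_zero_of_mul hw), hHV w (right_ne_zero_of_mul hw)⟩

lemma isIrreducible_univ_hirzebruch (m : ℕ) : IsIrreducible (Set.univ : Set (Hirzebruch m)) := by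
  refine ⟨⟨chart m 0 0 0, trivial⟩, ?_⟩
  rw [← (mk_surjective m).range_eq, ← Set.image_univ]
  exact PreirreducibleSpace.isPreirreducible_univ.image _ (continuous_mk m).continuousOn

lemma Form.zeroSet_ne_univ {m : ℕ} (G : Form m) : G.zeroSet ≠ Set.univ := by
  intro h
  obtain ⟨v, hv⟩ := exists_cone_eval_ne G.2.1
  have : v ∈ mk m ⁻¹' G.zeroSet := by rw [h]; trivial
  rw [G.preimage_zeroSet] at this
  exact hv this

lemma chart_surjective {m : ℕ} (P : Hirzebruch m) : ∃ i j q, chart m i j q = P := by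
  obtain ⟨v, rfl⟩ := mk_surjective m P
  obtain ⟨⟨i, hi⟩, ⟨j, hj⟩⟩ := v.2
  have hy (l : ℂ) (hl : l * v.1 (Sum.inr j) = 1) (k : Fin 2) :
      l * v.1 (Sum.inr k) = if k = j then 1 else l * v.1 (Sum.inr (1 - j)) := by
    fin_cases j <;> fin_cases k <;> simp_all
  have hl : (v.1 (Sum.inr j))⁻¹ * v.1 (Sum.inr j) = 1 := inv_mul_cancel₀ hj
  have hl0 : (v.1 (Sum.inr j))⁻¹ ≠ 0 := inv_ne_zero hj
  have hi2 : i = 0 ∨ i = 1 := by fin_cases i <;> simp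
  generalize (v.1 (Sum.inr j))⁻¹ = l at hl hl0
  rcases hi2 with rfl | rfl
  · refine ⟨0, j, ![(l ^ m)⁻¹ * (v.1 (Sum.inl 0))⁻¹ * v.1 (Sum.inl 1),
      l * v.1 (Sum.inr (1 - j))], Quotient.sound
        ⟨l, (v.1 (Sum.inl 0))⁻¹, hl0, inv_ne_zero hi, ?_, ?_, ?_, ?_⟩⟩
    · simp [hi]
    · simp
    · exact (hy l hl 0).symm
    · exact (hy l hl 1).symm
  · refine ⟨1, j, ![l ^ m * (v.1 (Sum.inl 1))⁻¹ * v.1 (Sum.inl 0),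
      l * v.1 (Sum.inr (1 - j))], Quotient.sound
        ⟨l, l ^ m * (v.1 (Sum.inl 1))⁻¹, hl0,
          mul_ne_zero (pow_ne_zero _ hl0) (inv_ne_zero hi), ?_, ?_, ?_, ?_⟩⟩
    · simp
    · simp only [Sum.elim_inl, if_true]
      field_simp
    · exact (hy l hl 0).symm
    · exact (hy l hl 1).symm

lemma eval_dehom (i j : Fin 2) (q : Fin 2 → ℂ) (G : MvPolynomial Var ℂ) :
    eval q (dehom i j G) =
      eval (Sum.elim (fun k => if k = i then 1 else q 0) (fun k => if k = j then 1 else q 1)) G := by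
  rw [dehom, ← aeval_eq_eval, ← aeval_eq_eval, ← AlgHom.comp_apply]
  congr 1
  ext s
  rcases s with s | s <;> simp <;> split_ifs <;> simp

lemma ne_zero_of_toNat_iInf_ne_zero {f : Fin 2 → Fin 2 → ℕ∞}
    (h : (⨅ (i : Fin 2) (j : Fin 2), f i j).toNat ≠ 0) (i j : Fin 2) : f i j ≠ 0 := by
  intro h0
  have h1 : (⨅ (i : Fin 2) (j : Fin 2), f i j) ≤ f i j :=
    (iInf_le _ i).trans (iInf_le _ j)
  rw [h0, nonpos_iff_eq_zero] at h1
  rw [h1] at h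
  exact h ENat.toNat_zero

lemma Form.subset_zeroSet_of_ord_ne_zero {m : ℕ} (G : Form m) (Z : PrimeDivisor m)
    (h : G.ord Z ≠ 0) : Z.pts ⊆ G.zeroSet := by
  intro P hP
  obtain ⟨i, j, q, rfl⟩ := chart_surjective P
  have h1 : ordAt (Z.ideal i j) (dehom i j G.1) ≠ 0 :=
    ne_zero_of_toNat_iInf_ne_zero h i j
  have h2 : dehom i j G.1 ∈ Z.ideal i j := by
    by_contra hn
    apply h1
    simp only [ordAt, ENat.iSup_eq_zero]
    intro n hmem
    rcases Nat.eq_zero_or_pos n with rfl | hn'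
    · rfl
    · exact absurd (Ideal.pow_le_self hn'.ne' hmem) hn
  have h3 := h2 q hP
  rw [aeval_eq_eval] at h3
  exact ⟨_, rfl, (eval_dehom i j q G.1).symm.trans h3⟩

lemma Form.finite_ord_ne_zero {m : ℕ} (G : Form m) : {Z | G.ord Z ≠ 0}.Finite := by
  obtain ⟨S, hS, hSc, hSi, hSU⟩ :=
    TopologicalSpace.NoetherianSpace.exists_finite_set_isClosed_irreducible G.isClosed_zeroSet
  refine Set.Finite.of_finite_image (f := PrimeDivisor.pts) (hS.subset ?_) ?_
  · rintro _ ⟨Z, hZ, rfl⟩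
    have hsub := G.subset_zeroSet_of_ord_ne_zero Z hZ
    rw [hSU] at hsub
    obtain ⟨t, ht, hZt⟩ := isIrreducible_iff_sUnion_isClosed.1 Z.1.isIrreducible hS.toFinset
      (by simpa using hSc) (by simpa [PrimeDivisor.pts] using hsub)
    rw [Set.Finite.mem_toFinset] at ht
    let T : TopologicalSpace.IrreducibleCloseds (Hirzebruch m) := ⟨t, hSi t ht, hSc t ht⟩
    let E : TopologicalSpace.IrreducibleCloseds (Hirzebruch m) :=
      ⟨Set.univ, isIrreducible_univ_hirzebruch m, isClosed_univ⟩
    have hTE : T < E := by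
      refine lt_of_le_of_ne (fun x _ => trivial) fun hTE => G.zeroSet_ne_univ ?_
      have : t = Set.univ := congrArg (fun W : TopologicalSpace.IrreducibleCloseds (Hirzebruch m) => W.carrier) hTE
      rw [hSU]
      exact Set.univ_subset_iff.mp (this ▸ Set.subset_sUnion_of_mem ht)
    have hZT : Z.1 ≤ T := hZt
    rcases hZT.lt_or_eq with hlt | heq
    · have e1 := Order.coheight_add_one_le hlt
      have e2 := Order.coheight_add_one_le hTE
      rw [Z.2] at e1
      have : (1 : ℕ∞) ≤ Order.coheight T := le_trans (by simp) e2
      have h2 : (1 : ℕ∞) + 1 ≤ 1 := le_trans (by gcongr) e1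
      norm_num at h2
    · have : Z.pts = t := congrArg (fun W : TopologicalSpace.IrreducibleCloseds (Hirzebruch m) => W.carrier) heq
      rw [this]
      exact ht
  · intro Z _ W _ h
    exact Subtype.ext (TopologicalSpace.IrreducibleCloseds.ext h)

/-! ### Divisors, linear equivalence, and local invariants -/

/-- The divisor of zeros of a form. -/
def Form.div {m : ℕ} (G : Form m) : Divisor m :=
  Finsupp.ofSupportFinite (fun Z => (G.ord Z : ℤ))
    (G.finite_ord_ne_zero.subset fun Z hZ => by
      simpa [Function.mem_support] using hZ)

/-- Linear equivalence: `D - E` is the divisor of a nonzero rational function `P / Q`, where `P` and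
`Q` are forms of the same degree. -/
def LinEquiv {m : ℕ} (D E : Divisor m) : Prop :=
  ∃ P Q : Form m, (∃ d : ℤ × ℤ, P.1.IsWeightedHomogeneous (wt m) d ∧
    Q.1.IsWeightedHomogeneous (wt m) d) ∧ D - E = P.div - Q.div

/-- The section `S₊`, given by `x₀ = 0`. -/
def sPlus (m : ℕ) : Divisor m := (Form.var m (Sum.inl 0)).div

/-- The fiber given by `y₁ = 0`. -/
def fiber (m : ℕ) : Divisor m := (Form.var m (Sum.inr 1)).div

/-- A divisor is irreducible if it is a prime divisor. -/
def IsIrreducibleDivisor {m : ℕ} (D : Divisor m) : Prop :=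
  ∃ Z : PrimeDivisor m, D = Finsupp.single Z 1

/-- The zero set of the form `G` is a prime divisor that occurs in `D`. -/
def IsComponent {m : ℕ} (G : Form m) (D : Divisor m) : Prop :=
  ∃ Z : PrimeDivisor m, Z.pts = G.zeroSet ∧ D Z ≠ 0

/-- The ideal, in the chart `(i, j)`, of an effective divisor `D = ∑ n_Z Z`: the functions that
vanish to order at least `n_Z` along every prime divisor `Z`. -/
def divisorIdeal {m : ℕ} (D : Divisor m) (i j : Fin 2) : Ideal (MvPolynomial (Fin 2) ℂ) :=
  ⨅ Z : PrimeDivisor m, Z.ideal i j ^ (D Z).toNat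

/-- The multiplicity at `q ∈ 𝔸²` of the plane curve with ideal `I`: the largest `n` such that
`I` is contained in the `n`-th power of the maximal ideal of `q`. -/
def planeMult (I : Ideal (MvPolynomial (Fin 2) ℂ)) (q : Fin 2 → ℂ) : ℕ∞ :=
  ⨆ (n : ℕ) (_ : I ≤ vanishingIdeal ℂ {q} ^ n), (n : ℕ∞)

/-- The local intersection number `dim_ℂ 𝒪_q / (I + J)` at `q ∈ 𝔸²` of the plane curves with
ideals `I` and `J`. -/
def planeInter (I J : Ideal (MvPolynomial (Fin 2) ℂ)) (q : Fin 2 → ℂ) : ℕ∞ :=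
  Cardinal.toENat (Module.rank ℂ
    (Localization.AtPrime (vanishingIdeal ℂ {q}) ⧸
      (I ⊔ J).map (algebraMap (MvPolynomial (Fin 2) ℂ)
        (Localization.AtPrime (vanishingIdeal ℂ {q})))))

/-- The tangent cone at `q ∈ 𝔸²` of the plane curve with ideal `I`: the common zeros of the
homogeneous parts of degree `planeMult I q` of the Taylor expansions at `q` of the elements of `I`.
Its nonzero vectors are the tangent directions. -/
def planeTangentCone (I : Ideal (MvPolynomial (Fin 2) ℂ)) (q : Fin 2 → ℂ) : Set (Fin 2 → ℂ) :=
  {v | ∀ h ∈ I, eval v (homogeneousComponent (planeMult I q).toNat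
    (aeval (fun k => X k + C (q k)) h)) = 0}

/-- The multiplicity `m_P(D)` of an effective divisor, computed in any chart containing `P`
(all charts containing `P` give the same value). -/
def multAt {m : ℕ} (D : Divisor m) (P : Hirzebruch m) : ℕ∞ :=
  ⨅ (i : Fin 2) (j : Fin 2) (q : Fin 2 → ℂ) (_ : chart m i j q = P),
    planeMult (divisorIdeal D i j) q

/-- The local intersection number `I_P(D, E)` of two effective divisors, computed in any chart
containing `P` (all charts containing `P` give the same value). -/
def interAt {m : ℕ} (D E : Divisor m) (P : Hirzebruch m) : ℕ∞ :=
  ⨅ (i : Fin 2) (j : Fin 2) (q : Fin 2 → ℂ) (_ : chart m i j q = P),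
    planeInter (divisorIdeal D i j) (divisorIdeal E i j) q

/-- Two effective divisors have the same tangent directions at `P`. -/
def SameTangents {m : ℕ} (D E : Divisor m) (P : Hirzebruch m) : Prop :=
  ∀ (i j : Fin 2) (q : Fin 2 → ℂ), chart m i j q = P →
    planeTangentCone (divisorIdeal D i j) q = planeTangentCone (divisorIdeal E i j) q

/-- The Newton polygon of `F ∈ ℂ[x, y]`. -/
def newtonPolygon (F : MvPolynomial (Fin 2) ℂ) : Set (ℝ × ℝ) :=
  convexHull ℝ ((fun e : Fin 2 →₀ ℕ => ((e 0 : ℝ), (e 1 : ℝ))) '' (F.support : Set (Fin 2 →₀ ℕ)))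

/-- `F` is a (nonzero) polynomial of bidegree `(a, b)`: its Newton polygon lies in the triangle
spanned by `(a, 0)`, `(0, 0)` and `(0, b)`. -/
def HasBidegree (F : MvPolynomial (Fin 2) ℂ) (a b : ℕ) : Prop :=
  F ≠ 0 ∧ newtonPolygon F ⊆ convexHull ℝ {((a : ℝ), (0 : ℝ)), (0, 0), (0, (b : ℝ))}

/-- `D` restricts on `𝔸²`, embedded by `(x, y) ↦ [x : 1 ; y : 1]`, to the divisor of zeros of `F`.
The prime divisors of `𝔸²` are the traces of the prime divisors `Z` of `𝔽_m` that meet `𝔸²`. -/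
def RestrictsTo {m : ℕ} (D : Divisor m) (F : MvPolynomial (Fin 2) ℂ) : Prop :=
  ∀ Z : PrimeDivisor m, (chart m 1 1 ⁻¹' Z.pts).Nonempty →
    ((D Z).toNat : ℕ∞) = ordAt (Z.ideal 1 1) F

/-- `D` is an `(a, am)`-divisor of the polynomial `F` of bidegree `(a, am)`. -/
structure IsDivisorOf {m : ℕ} (a : ℕ) (F : MvPolynomial (Fin 2) ℂ) (D : Divisor m) : Prop where
  bidegree : HasBidegree F a (a * m)
  effective : 0 ≤ D
  linEquiv : LinEquiv D (a • sPlus m)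
  restrictsTo : RestrictsTo D F

/-- The polynomial `∑ x₀ⁱ x₁^(a-i) g_i(y₀, y₁)`, the sum being over `0 ≤ i ≤ a`. -/
def formSum (a : ℕ) (g : ℕ → MvPolynomial (Fin 2) ℂ) : MvPolynomial Var ℂ :=
  ∑ i ∈ Finset.range (a + 1),
    X (Sum.inl 0) ^ i * X (Sum.inl 1) ^ (a - i) * rename Sum.inr (g i)

/-- `D` is the zero divisor of `G = ∑ x₀ⁱ x₁^(a-i) g_i(y₀, y₁)`, where `g_i` is homogeneous of
degree `m (a - i)`. -/
def IsZeroDivisorOf {m : ℕ} (a : ℕ) (g : ℕ → MvPolynomial (Fin 2) ℂ) (D : Divisor m) : Prop :=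
  (∀ i ≤ a, (g i).IsHomogeneous (m * (a - i))) ∧
    ∃ G : Form m, G.1 = formSum a g ∧ G.div = D

/-- The point `[0 : 1 ; 1 : 0]`. -/
def pointP (m : ℕ) : Hirzebruch m :=
  mk m ⟨Sum.elim ![0, 1] ![1, 0], ⟨1, by simp⟩, ⟨0, by simp⟩⟩

end HirzebruchSurface

end

open HirzebruchSurface

/-!
The homogeneous coordinate ring `ℂ[x₀, x₁, y₀, y₁]` of `𝔽_m` is a unique factorization domain, and
all divisor theory on `𝔽_m` used here is factorization in it. A factor of a form is a form
(`exists_isWeightedHomogeneous_of_dvd`), every proper closed subset lies in the zero set of a form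
(`exists_form_of_isClosed`), and by the Nullstellensatz, the locus `x = 0` or `y = 0` removed from
`𝔸⁴` being of codimension two, the prime divisors are exactly the zero sets of the irreducible forms
(`PrimeDivisor.ofForm`, `PrimeDivisor.exists_eq_zeroSet`). Divisibility on a chart is divisibility
of forms up to powers of the two coordinates that are invertible there (`dehom_dvd_dehom_iff`).
Hence the ideal of a prime divisor on a chart is generated by its dehomogenized equation, and the
order of a form along it is the multiplicity of that equation in the form (`Form.ord_eq`). It
follows that the effective divisors are the divisors of forms, that the form is determined up to a
constant (`Form.associated_iff`), and that the class of `a S₊` corresponds to the degree `(a, 0)`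
(`exists_div_eq_of_linEquiv`).

A form of degree `(a, 0)` is determined by its restriction to `x₁ = y₁ = 1`, and the restrictions
are exactly the polynomials of bidegree `(a, am)`. This is `isDivisorOf_iff`, which gives the
correspondence between polynomials and divisors. Irreducibility passes from the form to the
polynomial because `x₁` and `y₁` do not have degree `(a, 0)`.

The monomial `x ^ i * y ^ j` homogenizes to `x₀ ^ i * x₁ ^ (a-i) * y₀ ^ j * y₁ ^ (m(a-i)-j)`, so the
inequality that defines the bidegree `(a, am - r)` is a lower bound for the exponent of `y₁`
(`bidegree_bound_iff`). In the chart `x₁ = y₀ = 1` around `p` it says that the Newton polygon of the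
local equation `f` of the divisor lies above the line through `(0, r)` and `(a, 0)`
(`exists_form_forall_hasBidegree_iff`). For `r = 1` this means that `f(x, 0)` is a multiple of
`x ^ a`, and its order is the intersection number with `y₁ = 0` (`planeInter_span_X_one`). For
`a = 3`, `r = 2` it means that `f` has no terms of degree at most two besides `y₁ ^ 2`
(`mult_and_tangent_iff`).
-/

noncomputable section

namespace HirzebruchSurface

/-! ### Weighted gradings -/

section Grading

variable {σ R : Type*}

/-- The homomorphism `X s ↦ X s * T ^ w s` into polynomials in `T`: the coefficient of `T ^ k` in
the image of `p` is the component of `p` of weight `k`. -/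
def gradingHom [CommRing R] (w : σ → ℕ) : MvPolynomial σ R →ₐ[R] Polynomial (MvPolynomial σ R) :=
  aeval fun s => Polynomial.monomial (w s) (X s)

lemma gradingHom_monomial [CommRing R] (w : σ → ℕ) (e : σ →₀ ℕ) (c : R) :
    gradingHom w (monomial e c) = Polynomial.monomial (Finsupp.weight w e) (monomial e c) := by
  rw [gradingHom, aeval_monomial, Finsupp.weight_apply]
  have : (e.prod fun s k => Polynomial.monomial (w s) (X s : MvPolynomial σ R) ^ k)
      = Polynomial.monomial (e.sum fun s k => k • w s) (monomial e 1) := by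
    rw [Finsupp.prod, Finsupp.sum, monomial_eq, Finsupp.prod, C_1, one_mul]
    generalize e.support = T
    induction T using Finset.cons_induction with
    | empty => simp
    | cons s T hs ih =>
      rw [Finset.prod_cons, ih, Finset.sum_cons, Finset.prod_cons, Polynomial.monomial_pow,
        Polynomial.monomial_mul_monomial, smul_eq_mul, mul_comm (w s)]
  rw [this, IsScalarTower.algebraMap_apply R (MvPolynomial σ R) (Polynomial (MvPolynomial σ R)),
    Polynomial.algebraMap_eq, Polynomial.C_mul_monomial, algebraMap_eq, C_mul_monomial, mul_one]

lemma coeff_gradingHom [CommRing R] (w : σ → ℕ) (p : MvPolynomial σ R) (k : ℕ) :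
    (gradingHom w p).coeff k = weightedHomogeneousComponent w k p := by
  classical
  induction p using MvPolynomial.induction_on' with
  | monomial e c =>
    ext d
    rw [gradingHom_monomial, Polynomial.coeff_monomial, coeff_weightedHomogeneousComponent]
    by_cases h : e = d
    · subst h
      split_ifs <;> simp
    · rw [coeff_monomial, if_neg h, ite_self]
      split_ifs
      · rw [coeff_monomial, if_neg h]
      · rw [coeff_zero]
  | add p q hp hq => simp [hp, hq]

lemma isWeightedHomogeneous_iff_gradingHom [CommRing R] (w : σ → ℕ) (p : MvPolynomial σ R)
    (n : ℕ) : p.IsWeightedHomogeneous w n ↔ gradingHom w p = Polynomial.monomial n p := by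
  constructor
  · intro h
    ext1 k
    rw [coeff_gradingHom, Polynomial.coeff_monomial]
    split_ifs with hk
    · rw [← hk, h.weightedHomogeneousComponent_same]
    · exact h.weightedHomogeneousComponent_ne k (Ne.symm hk)
  · intro h
    have := coeff_gradingHom w p n
    rw [h, Polynomial.coeff_monomial, if_pos rfl] at this
    rw [this]
    exact weightedHomogeneousComponent_isWeightedHomogeneous n p

lemma eval_one_gradingHom [CommRing R] (w : σ → ℕ) (p : MvPolynomial σ R) :
    (gradingHom w p).eval 1 = p := by
  induction p using MvPolynomial.induction_on' with
  | monomial e c => rw [gradingHom_monomial, Polynomial.eval_monomial, one_pow, mul_one]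
  | add p q hp hq => rw [map_add, Polynomial.eval_add, hp, hq]

/-- A factor of a weighted homogeneous polynomial is weighted homogeneous. -/
lemma exists_isWeightedHomogeneous_of_mul [CommRing R] [IsDomain R] {w : σ → ℕ}
    {p q : MvPolynomial σ R} (h : p * q ≠ 0) {n : ℕ} (hpq : (p * q).IsWeightedHomogeneous w n) :
    ∃ k, p.IsWeightedHomogeneous w k := by
  rw [isWeightedHomogeneous_iff_gradingHom, map_mul] at hpq
  have hne : gradingHom w p * gradingHom w q ≠ 0 := by
    rw [hpq]
    simpa using h
  have hp := left_ne_zero_of_mul hne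
  have hq := right_ne_zero_of_mul hne
  have h1 := Polynomial.natDegree_mul hp hq
  have h2 := Polynomial.natTrailingDegree_mul hp hq
  rw [hpq, Polynomial.natDegree_monomial_eq _ h] at h1
  rw [hpq, Polynomial.natTrailingDegree_monomial h] at h2
  have h3 := Polynomial.natTrailingDegree_le_natDegree (gradingHom w p)
  have h4 := Polynomial.natTrailingDegree_le_natDegree (gradingHom w q)
  refine ⟨(gradingHom w p).natDegree, (isWeightedHomogeneous_iff_gradingHom _ _ _).2 ?_⟩
  have h5 : gradingHom w p = Polynomial.monomial (gradingHom w p).natDegree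
      ((gradingHom w p).coeff (gradingHom w p).natDegree) := by
    ext1 k
    rw [Polynomial.coeff_monomial]
    split_ifs with hk
    · rw [hk]
    · rcases lt_or_gt_of_ne hk with hk | hk
      · exact Polynomial.coeff_eq_zero_of_natDegree_lt hk
      · exact Polynomial.coeff_eq_zero_of_lt_natTrailingDegree (by omega)
  have h6 := eval_one_gradingHom w p
  rw [h5, Polynomial.eval_monomial, one_pow, mul_one] at h6
  rwa [h6] at h5

lemma eval_gradingHom [CommRing R] (w : σ → ℕ) (p : MvPolynomial σ R) (v : σ → R) (t : R) :
    ((gradingHom w p).map (eval v)).eval t = eval (fun s => t ^ w s * v s) p := by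
  induction p using MvPolynomial.induction_on' with
  | monomial e c =>
    rw [gradingHom_monomial, Polynomial.map_monomial, Polynomial.eval_monomial, eval_monomial,
      eval_monomial, Finsupp.weight_apply, Finsupp.sum, Finsupp.prod, Finsupp.prod,
      ← Finset.prod_pow_eq_pow_sum, mul_assoc, ← Finset.prod_mul_distrib]
    congr 1
    refine Finset.prod_congr rfl fun s _ => ?_
    rw [mul_pow, smul_eq_mul, mul_comm (e s), pow_mul, mul_comm]
  | add p q hp hq => rw [map_add, Polynomial.map_add, Polynomial.eval_add, hp, hq, map_add]

/-- If a polynomial vanishes on the punctured orbit of `v` under a weighted `𝔾ₘ`-action, then so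
do all its weighted components at `v`. -/
lemma eval_weightedHomogeneousComponent_eq_zero {w : σ → ℕ} {p : MvPolynomial σ ℂ} {v : σ → ℂ}
    (h : ∀ t : ℂ, t ≠ 0 → eval (fun s => t ^ w s * v s) p = 0) (k : ℕ) :
    eval v (weightedHomogeneousComponent w k p) = 0 := by
  have h0 : (gradingHom w p).map (eval v) = 0 := by
    refine Polynomial.eq_zero_of_infinite_isRoot _
      (((Set.finite_singleton (0 : ℂ)).infinite_compl).mono fun t ht => ?_)
    rw [Set.mem_ofPred_eq, Polynomial.IsRoot, eval_gradingHom]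
    exact h t ht
  rw [← coeff_gradingHom, ← Polynomial.coeff_map, h0, Polynomial.coeff_zero]

end Grading

/-- The weights of the grading by the degree in `x₀, x₁`. -/
def wtX : Var → ℕ := Sum.elim (fun _ => 1) (fun _ => 0)

/-- A nonnegative combination of the two components of the weight `wt m`: the second component
plus `m` times the first one. -/
def wtY (m : ℕ) : Var → ℕ := Sum.elim ![m, 0] (fun _ => 1)

lemma weight_wt (m : ℕ) (e : Var →₀ ℕ) :
    Finsupp.weight (wt m) e = ((e (Sum.inl 0) + e (Sum.inl 1) : ℤ),
      (e (Sum.inr 0) + e (Sum.inr 1) - m * e (Sum.inl 1) : ℤ)) := by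
  rw [Finsupp.weight_apply, Finsupp.sum_fintype _ _ (by simp)]
  ext
  · simp [Fintype.sum_sum_type, Fin.sum_univ_two, wt]
  · simp [Fintype.sum_sum_type, Fin.sum_univ_two, wt]
    ring

lemma weight_wtX (e : Var →₀ ℕ) :
    Finsupp.weight wtX e = e (Sum.inl 0) + e (Sum.inl 1) := by
  rw [Finsupp.weight_apply, Finsupp.sum_fintype _ _ (by simp)]
  simp [Fintype.sum_sum_type, Fin.sum_univ_two, wtX]

lemma weight_wtY (m : ℕ) (e : Var →₀ ℕ) :
    Finsupp.weight (wtY m) e = m * e (Sum.inl 0) + e (Sum.inr 0) + e (Sum.inr 1) := by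
  rw [Finsupp.weight_apply, Finsupp.sum_fintype _ _ (by simp)]
  simp [Fintype.sum_sum_type, Fin.sum_univ_two, wtY]
  ring

lemma exists_isWeightedHomogeneous_wt_iff (m : ℕ) {G : MvPolynomial Var ℂ} (hG : G ≠ 0) :
    (∃ d, G.IsWeightedHomogeneous (wt m) d) ↔
      (∃ n, G.IsWeightedHomogeneous wtX n) ∧ ∃ n, G.IsWeightedHomogeneous (wtY m) n := by
  obtain ⟨e₀, he₀⟩ := exists_coeff_ne_zero hG
  constructor
  · rintro ⟨d, hd⟩
    have key : ∀ e, coeff e G ≠ 0 → Finsupp.weight (wt m) e = Finsupp.weight (wt m) e₀ :=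
      fun e he => (hd he).trans (hd he₀).symm
    simp only [weight_wt, Prod.mk.injEq] at key
    refine ⟨⟨Finsupp.weight wtX e₀, fun e he => ?_⟩, ⟨Finsupp.weight (wtY m) e₀, fun e he => ?_⟩⟩
    · have := key e he
      rw [weight_wtX, weight_wtX]
      omega
    · obtain ⟨h1, h2⟩ := key e he
      rw [weight_wtY, weight_wtY]
      zify
      linear_combination h2 + m * h1
  · rintro ⟨⟨n, hn⟩, ⟨k, hk⟩⟩
    refine ⟨(n, k - m * n), fun e he => ?_⟩
    have h1 := hn he
    have h2 := hk he
    rw [weight_wtX] at h1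
    rw [weight_wtY] at h2
    rw [weight_wt, ← h1, ← h2]
    ext <;> push_cast <;> ring

/-- The divisors of a form are forms. -/
lemma exists_isWeightedHomogeneous_of_dvd (m : ℕ) {P G : MvPolynomial Var ℂ} (hG : G ≠ 0)
    (hd : ∃ d, G.IsWeightedHomogeneous (wt m) d) (h : P ∣ G) :
    ∃ d, P.IsWeightedHomogeneous (wt m) d := by
  obtain ⟨Q, rfl⟩ := h
  obtain ⟨⟨n, hn⟩, ⟨k, hk⟩⟩ := (exists_isWeightedHomogeneous_wt_iff m hG).1 hd
  exact (exists_isWeightedHomogeneous_wt_iff m (left_ne_zero_of_mul hG)).2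
    ⟨exists_isWeightedHomogeneous_of_mul hG hn, exists_isWeightedHomogeneous_of_mul hG hk⟩

lemma isWeightedHomogeneous_weightedHomogeneousComponent {σ M N : Type*} [AddCommMonoid M]
    [AddCommMonoid N] {w : σ → M} {w' : σ → N} {p : MvPolynomial σ ℂ} {n : M}
    (hp : p.IsWeightedHomogeneous w n) (k : N) :
    (weightedHomogeneousComponent w' k p).IsWeightedHomogeneous w n := by
  classical
  intro e he
  rw [coeff_weightedHomogeneousComponent] at he
  refine hp fun h => he ?_
  rw [h, ite_self]

lemma exists_weightedHomogeneousComponent_ne_zero {σ : Type*} (w : σ → ℕ) {p : MvPolynomial σ ℂ}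
    (hp : p ≠ 0) : ∃ k, weightedHomogeneousComponent w k p ≠ 0 := by
  obtain ⟨e, he⟩ := exists_coeff_ne_zero hp
  refine ⟨Finsupp.weight w e, fun h => he ?_⟩
  have := congrArg (coeff e) h
  rwa [coeff_weightedHomogeneousComponent, if_pos rfl, coeff_zero] at this

/-- A proper closed subset of `𝔽_m` is contained in the zero set of a form. -/
lemma exists_form_of_isClosed {m : ℕ} {Z : Set (Hirzebruch m)} (hZ : IsClosed Z)
    (hne : Z ≠ Set.univ) : ∃ G : Form m, Z ⊆ G.zeroSet := by
  obtain ⟨P, hP⟩ := (Set.ne_univ_iff_exists_notMem Z).1 hne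
  obtain ⟨v, rfl⟩ := mk_surjective m P
  obtain ⟨G, hG, hGZ⟩ := exists_basic_of_isOpen
    (hZ.isOpen_compl.preimage (continuous_mk m)) (v := v) hP
  have h0 : ∀ w : Cone, mk m w ∈ Z → eval w.1 G = 0 := fun w hw => by
    by_contra hn
    exact hGZ w hn hw
  obtain ⟨k, hk⟩ := exists_weightedHomogeneousComponent_ne_zero wtX hG
  obtain ⟨l, hl⟩ := exists_weightedHomogeneousComponent_ne_zero (wtY m) hk
  have h1 : ∀ w : Cone, mk m w ∈ Z → eval w.1 (weightedHomogeneousComponent wtX k G) = 0 := by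
    refine fun w hw => eval_weightedHomogeneousComponent_eq_zero (fun t ht => ?_) k
    refine h0 ⟨fun s => t ^ wtX s * w.1 s, ?_, ?_⟩ ?_
    · obtain ⟨i, hi⟩ := w.2.1
      exact ⟨i, by simp [wtX, ht, hi]⟩
    · obtain ⟨i, hi⟩ := w.2.2
      exact ⟨i, by simp [wtX, hi]⟩
    · convert hw using 1
      exact Quotient.sound ⟨1, t, one_ne_zero, ht, by simp [wtX], by simp [wtX], by simp [wtX],
        by simp [wtX]⟩
  have h2 : ∀ w : Cone, mk m w ∈ Z →
      eval w.1 (weightedHomogeneousComponent (wtY m) l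
        (weightedHomogeneousComponent wtX k G)) = 0 := by
    refine fun w hw => eval_weightedHomogeneousComponent_eq_zero (fun t ht => ?_) l
    refine h1 ⟨fun s => t ^ wtY m s * w.1 s, ?_, ?_⟩ ?_
    · obtain ⟨i, hi⟩ := w.2.1
      refine ⟨i, ?_⟩
      fin_cases i <;> simp_all [wtY]
    · obtain ⟨i, hi⟩ := w.2.2
      exact ⟨i, by simp [wtY, hi, ht]⟩
    · convert hw using 1
      refine Quotient.sound ⟨t, t ^ m, ht, pow_ne_zero _ ht, by simp [wtY], ?_, by simp [wtY],
        by simp [wtY]⟩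
      simp [wtY, ht]
  refine ⟨⟨_, hl, (exists_isWeightedHomogeneous_wt_iff m hl).2 ⟨⟨k, ?_⟩, ⟨l, ?_⟩⟩⟩, ?_⟩
  · exact isWeightedHomogeneous_weightedHomogeneousComponent
      (weightedHomogeneousComponent_isWeightedHomogeneous _ _) _
  · exact weightedHomogeneousComponent_isWeightedHomogeneous _ _
  · intro P hP
    obtain ⟨w, rfl⟩ := mk_surjective m P
    exact ⟨w, rfl, h2 w hP⟩

/-! ### Dehomogenization and homogenization -/

lemma exists_chart_eq_mk (m : ℕ) {v : Cone} {i j : Fin 2} (hi : v.1 (Sum.inl i) ≠ 0)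
    (hj : v.1 (Sum.inr j) ≠ 0) : ∃ q, chart m i j q = mk m v := by
  have hy (l : ℂ) (hl : l * v.1 (Sum.inr j) = 1) (k : Fin 2) :
      l * v.1 (Sum.inr k) = if k = j then 1 else l * v.1 (Sum.inr (1 - j)) := by
    fin_cases j <;> fin_cases k <;> simp_all
  have hl : (v.1 (Sum.inr j))⁻¹ * v.1 (Sum.inr j) = 1 := inv_mul_cancel₀ hj
  have hl0 : (v.1 (Sum.inr j))⁻¹ ≠ 0 := inv_ne_zero hj
  have hi2 : i = 0 ∨ i = 1 := by fin_cases i <;> simp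
  generalize (v.1 (Sum.inr j))⁻¹ = l at hl hl0
  rcases hi2 with rfl | rfl
  · refine ⟨![(l ^ m)⁻¹ * (v.1 (Sum.inl 0))⁻¹ * v.1 (Sum.inl 1),
      l * v.1 (Sum.inr (1 - j))], Quotient.sound
        ⟨l, (v.1 (Sum.inl 0))⁻¹, hl0, inv_ne_zero hi, ?_, ?_, ?_, ?_⟩⟩
    · simp [hi]
    · simp
    · exact (hy l hl 0).symm
    · exact (hy l hl 1).symm
  · refine ⟨![l ^ m * (v.1 (Sum.inl 1))⁻¹ * v.1 (Sum.inl 0),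
      l * v.1 (Sum.inr (1 - j))], Quotient.sound
        ⟨l, l ^ m * (v.1 (Sum.inl 1))⁻¹, hl0,
          mul_ne_zero (pow_ne_zero _ hl0) (inv_ne_zero hi), ?_, ?_, ?_, ?_⟩⟩
    · simp
    · simp only [Sum.elim_inl, if_true]
      field_simp
    · exact (hy l hl 0).symm
    · exact (hy l hl 1).symm

lemma chart_mem_zeroSet_iff {m : ℕ} (G : Form m) (i j : Fin 2) (q : Fin 2 → ℂ) :
    chart m i j q ∈ G.zeroSet ↔ eval q (dehom i j G.1) = 0 := by
  rw [eval_dehom]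
  constructor
  · rintro ⟨w, hw, h0⟩
    exact (eval_eq_zero_iff_of_rel m G hw).1 h0
  · exact fun h => ⟨_, rfl, h⟩

lemma dehom_X_inl (i j : Fin 2) : dehom i j (X (Sum.inl i)) = 1 := by simp [dehom]

lemma dehom_X_inr (i j : Fin 2) : dehom i j (X (Sum.inr j)) = 1 := by simp [dehom]

lemma Form.dehom_ne_zero {m : ℕ} (G : Form m) (i j : Fin 2) : dehom i j G.1 ≠ 0 := by
  intro h
  obtain ⟨v, hv⟩ := exists_cone_eval_ne
    (mul_ne_zero G.2.1 (mul_ne_zero (X_ne_zero (R := ℂ) (Sum.inl i)) (X_ne_zero (Sum.inr j))))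
  rw [map_mul, map_mul, eval_X, eval_X] at hv
  obtain ⟨q, hq⟩ := exists_chart_eq_mk m (left_ne_zero_of_mul (right_ne_zero_of_mul hv))
    (right_ne_zero_of_mul (right_ne_zero_of_mul hv))
  have h1 := (chart_mem_zeroSet_iff G i j q).2 (by rw [h, map_zero])
  rw [hq] at h1
  obtain ⟨w, hw, h0⟩ := h1
  exact left_ne_zero_of_mul hv ((eval_eq_zero_iff_of_rel m G hw).1 h0)

lemma eq_of_dehom_eq {m : ℕ} {G H : MvPolynomial Var ℂ} {d : ℤ × ℤ}
    (hG : G.IsWeightedHomogeneous (wt m) d) (hH : H.IsWeightedHomogeneous (wt m) d)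
    {i j : Fin 2} (h : dehom i j G = dehom i j H) : G = H := by
  by_contra hne
  exact Form.dehom_ne_zero (⟨G - H, sub_ne_zero.2 hne, d, hG.sub hH⟩ : Form m) i j
    (by rw [map_sub, h, sub_self])

/-- Every polynomial on a chart is the dehomogenization of a homogeneous polynomial. -/
lemma exists_dehom_eq (m : ℕ) (i j : Fin 2) (h : MvPolynomial (Fin 2) ℂ) :
    ∃ H d, H.IsWeightedHomogeneous (wt m) d ∧ dehom i j H = h := by
  have hi : i = 0 ∨ i = 1 := by fin_cases i <;> simp
  have hj : j = 0 ∨ j = 1 := by fin_cases j <;> simp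
  set N := degreeOf 0 h + degreeOf 1 h with hN
  let M : (Fin 2 →₀ ℕ) → MvPolynomial Var ℂ := fun e =>
    C (coeff e h) * (X (Sum.inl (1 - i)) ^ e 0 * X (Sum.inl i) ^ (N - e 0) *
      X (Sum.inr (1 - j)) ^ e 1 *
      X (Sum.inr j) ^ (N + m * (if i = 1 then N - e 0 else e 0) - e 1))
  refine ⟨∑ e ∈ h.support, M e, (N, N), ?_, ?_⟩
  · refine IsWeightedHomogeneous.sum _ _ _ fun e he => IsWeightedHomogeneous.C_mul ?_ _
    have h0 : e 0 ≤ N := (monomial_le_degreeOf 0 he).trans (by omega)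
    have h1 : e 1 ≤ N := (monomial_le_degreeOf 1 he).trans (by omega)
    have key := ((((isWeightedHomogeneous_X ℂ (wt m) (Sum.inl (1 - i))).pow (e 0)).mul
      ((isWeightedHomogeneous_X ℂ (wt m) (Sum.inl i)).pow (N - e 0))).mul
      ((isWeightedHomogeneous_X ℂ (wt m) (Sum.inr (1 - j))).pow (e 1))).mul
      ((isWeightedHomogeneous_X ℂ (wt m) (Sum.inr j)).pow
        (N + m * (if i = 1 then N - e 0 else e 0) - e 1))
    convert key using 1
    rcases hi with rfl | rfl
    · rw [if_neg (by simp), show (1 - 0 : Fin 2) = 1 from rfl]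
      ext
      · simp [wt]
        omega
      · simp [wt]
        rw [Nat.cast_sub (h1.trans (Nat.le_add_right _ _))]
        push_cast
        ring
    · rw [if_pos rfl, show (1 - 1 : Fin 2) = 0 from rfl]
      ext
      · simp [wt]
        omega
      · simp [wt]
        rw [Nat.cast_sub (h1.trans (Nat.le_add_right _ _))]
        push_cast
        ring
  · rw [map_sum]
    conv_rhs => rw [h.as_sum]
    refine Finset.sum_congr rfl fun e he => ?_
    rw [monomial_eq, Finsupp.prod_fintype _ _ (by simp), Fin.prod_univ_two]
    simp only [M, map_mul, map_pow, dehom_X_inl, dehom_X_inr, one_pow, mul_one]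
    rw [← algebraMap_eq, AlgHom.commutes, ← algebraMap_eq]
    rcases hi with rfl | rfl <;> rcases hj with rfl | rfl <;> simp [dehom]

/-- Homogeneous polynomials with the same dehomogenization agree up to powers of the two
coordinates that are invertible on the chart. -/
lemma exists_mul_pow_eq_of_dehom_eq {m : ℕ} {G H : MvPolynomial Var ℂ} {d d' : ℤ × ℤ}
    (hG : G.IsWeightedHomogeneous (wt m) d) (hH : H.IsWeightedHomogeneous (wt m) d')
    {i j : Fin 2} (h : dehom i j G = dehom i j H) : ∃ k l k' l' : ℕ,
      G * (X (Sum.inl i) ^ k * X (Sum.inr j) ^ l)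
        = H * (X (Sum.inl i) ^ k' * X (Sum.inr j) ^ l') := by
  set ε : ℤ := (wt m (Sum.inl i)).2 with hε
  have h1 : (wt m (Sum.inl i)).1 = 1 := by fin_cases i <;> rfl
  have h2 : wt m (Sum.inr j) = (0, 1) := rfl
  obtain ⟨k, k', hk⟩ : ∃ k k' : ℕ, d.1 + k = d'.1 + k' :=
    ⟨(d'.1 - d.1).toNat, (d.1 - d'.1).toNat, by omega⟩
  obtain ⟨l, l', hl⟩ : ∃ l l' : ℕ, d.2 + k * ε + l = d'.2 + k' * ε + l' :=
    ⟨(d'.2 + k' * ε - (d.2 + k * ε)).toNat, (d.2 + k * ε - (d'.2 + k' * ε)).toNat, by omega⟩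
  refine ⟨k, l, k', l', eq_of_dehom_eq (m := m) (i := i) (j := j)
    (hG.mul (((isWeightedHomogeneous_X ℂ (wt m) (Sum.inl i)).pow k).mul
      ((isWeightedHomogeneous_X ℂ (wt m) (Sum.inr j)).pow l))) ?_ ?_⟩
  · convert hH.mul (((isWeightedHomogeneous_X ℂ (wt m) (Sum.inl i)).pow k').mul
      ((isWeightedHomogeneous_X ℂ (wt m) (Sum.inr j)).pow l')) using 1
    ext
    · simp [h1, h2, hk]
    · simp [h2, ← hε]
      linarith
  · simp only [map_mul, map_pow, dehom_X_inl, dehom_X_inr, one_pow, mul_one, h]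

/-- Divisibility on a chart is divisibility of homogeneous polynomials, up to powers of the two
coordinates that are invertible on the chart. -/
lemma dehom_dvd_dehom_iff {m : ℕ} {P G : MvPolynomial Var ℂ} {d d' : ℤ × ℤ}
    (hP : P.IsWeightedHomogeneous (wt m) d) (hG : G.IsWeightedHomogeneous (wt m) d')
    {i j : Fin 2} : dehom i j P ∣ dehom i j G ↔
      ∃ k l : ℕ, P ∣ G * (X (Sum.inl i) ^ k * X (Sum.inr j) ^ l) := by
  constructor
  · rintro ⟨h, hh⟩
    obtain ⟨H, d'', hH, rfl⟩ := exists_dehom_eq m i j h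
    rw [← map_mul] at hh
    obtain ⟨k, l, k', l', h1⟩ := exists_mul_pow_eq_of_dehom_eq hG (hP.mul hH) hh
    exact ⟨k, l, by rw [h1, mul_assoc]; exact dvd_mul_right _ _⟩
  · rintro ⟨k, l, h⟩
    have := map_dvd (dehom i j) h
    rwa [map_mul, map_mul, map_pow, map_pow, dehom_X_inl, dehom_X_inr, one_pow, one_pow, mul_one,
      mul_one] at this

/-- The chart `(i, j)` meets the zero set of an irreducible form `P`: neither of the coordinates
`x_i`, `y_j` whose zero sets are removed is divisible by `P`. -/
def MeetsChart (P : MvPolynomial Var ℂ) (i j : Fin 2) : Prop :=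
  ¬ P ∣ X (Sum.inl i) ∧ ¬ P ∣ X (Sum.inr j)

lemma MeetsChart.dvd_of_dvd_mul {P G : MvPolynomial Var ℂ} {i j : Fin 2} (h : MeetsChart P i j)
    (hP : Irreducible P) {n k l : ℕ}
    (hd : P ^ n ∣ G * (X (Sum.inl i) ^ k * X (Sum.inr j) ^ l)) : P ^ n ∣ G := by
  refine hP.prime.pow_dvd_of_dvd_mul_right n (fun h0 => ?_) hd
  rcases hP.prime.dvd_or_dvd h0 with h1 | h1
  · exact h.1 (hP.prime.dvd_of_dvd_pow h1)
  · exact h.2 (hP.prime.dvd_of_dvd_pow h1)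

lemma MeetsChart.pow_dehom_dvd_iff {m : ℕ} {P G : MvPolynomial Var ℂ} {i j : Fin 2}
    (h : MeetsChart P i j) (hP : Irreducible P) {d d' : ℤ × ℤ}
    (hPd : P.IsWeightedHomogeneous (wt m) d) (hG : G.IsWeightedHomogeneous (wt m) d') (n : ℕ) :
    dehom i j P ^ n ∣ dehom i j G ↔ P ^ n ∣ G := by
  rw [← map_pow]
  refine ⟨fun h1 => ?_, fun h1 => map_dvd _ h1⟩
  obtain ⟨k, l, h2⟩ := (dehom_dvd_dehom_iff (hPd.pow n) hG).1 h1
  exact h.dvd_of_dvd_mul hP h2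

lemma isUnit_dehom_of_not_meetsChart {P : MvPolynomial Var ℂ} {i j : Fin 2}
    (h : ¬ MeetsChart P i j) : IsUnit (dehom i j P) := by
  rw [MeetsChart, not_and_or, not_not, not_not] at h
  rcases h with h | h
  · have := map_dvd (dehom i j) h
    rw [dehom_X_inl] at this
    exact isUnit_of_dvd_one this
  · have := map_dvd (dehom i j) h
    rw [dehom_X_inr] at this
    exact isUnit_of_dvd_one this

lemma MeetsChart.prime_dehom {m : ℕ} {P : MvPolynomial Var ℂ} {i j : Fin 2}
    (h : MeetsChart P i j) (hP : Irreducible P) {d : ℤ × ℤ}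
    (hPd : P.IsWeightedHomogeneous (wt m) d) : Prime (dehom i j P) := by
  have key : ∀ {G : MvPolynomial Var ℂ} {d' : ℤ × ℤ}, G.IsWeightedHomogeneous (wt m) d' →
      (dehom i j P ∣ dehom i j G ↔ P ∣ G) := fun hG => by
    simpa using h.pow_dehom_dvd_iff hP hPd hG 1
  refine ⟨Form.dehom_ne_zero (⟨P, hP.ne_zero, d, hPd⟩ : Form m) i j, fun hu => ?_, ?_⟩
  · have h1 : dehom i j P ∣ dehom i j 1 := by
      rw [map_one]
      exact hu.dvd
    exact hP.not_isUnit (isUnit_of_dvd_one ((key (isWeightedHomogeneous_one ℂ (wt m))).1 h1))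
  · intro A B hAB
    obtain ⟨A, dA, hA, rfl⟩ := exists_dehom_eq m i j A
    obtain ⟨B, dB, hB, rfl⟩ := exists_dehom_eq m i j B
    rw [← map_mul, key (hA.mul hB)] at hAB
    rw [key hA, key hB]
    exact hP.prime.dvd_or_dvd hAB

lemma X_not_dvd_X_of_ne {s t : Var} (h : s ≠ t) :
    ¬ (X s : MvPolynomial Var ℂ) ∣ X t := fun hd => h (by simpa using X_dvd_X.1 hd)

/-- A form that divides `x₀` and `x₁`, or `y₀` and `y₁`, is constant; so every irreducible form
has a zero on some chart. -/
lemma exists_meetsChart {P : MvPolynomial Var ℂ} (hP : Irreducible P) :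
    ∃ i j, MeetsChart P i j := by
  have key : ∀ s t : Var, s ≠ t → ¬ P ∣ X s ∨ ¬ P ∣ X t := by
    intro s t hst
    by_contra! hc
    have h1 := (hP.associated_of_dvd (X_prime (i := s)).irreducible hc.1)
    exact X_not_dvd_X_of_ne hst (h1.dvd_iff_dvd_left.1 hc.2)
  obtain ⟨i, hi⟩ : ∃ i, ¬ P ∣ X (Sum.inl i) := by
    rcases key (Sum.inl 0) (Sum.inl 1) (by simp) with h | h
    exacts [⟨0, h⟩, ⟨1, h⟩]
  obtain ⟨j, hj⟩ : ∃ j, ¬ P ∣ X (Sum.inr j) := by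
    rcases key (Sum.inr 0) (Sum.inr 1) (by simp) with h | h
    exacts [⟨0, h⟩, ⟨1, h⟩]
  exact ⟨i, j, hi, hj⟩

/-! ### Prime divisors and irreducible forms -/

/-- The Nullstellensatz for hypersurfaces in `(𝔸² ∖ {0})²`. Nothing is lost by removing the
locus `x = 0` or `y = 0`, which has codimension two. -/
lemma dvd_of_eval_eq_zero {P H : MvPolynomial Var ℂ} (hP : Irreducible P)
    (h : ∀ v : Cone, eval v.1 P = 0 → eval v.1 H = 0) : P ∣ H := by
  obtain ⟨i, j, hij⟩ := exists_meetsChart hP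
  have : (Ideal.span {P}).IsPrime := (Ideal.span_singleton_prime hP.ne_zero).2 hP.prime
  have h1 : H * (X (Sum.inl i) ^ 1 * X (Sum.inr j) ^ 1) ∈ Ideal.span {P} := by
    rw [← IsPrime.vanishingIdeal_zeroLocus (K := ℂ) (Ideal.span {P}), mem_vanishingIdeal_iff]
    intro v hv
    rw [mem_zeroLocus_iff] at hv
    have hvP := hv P (Ideal.mem_span_singleton_self P)
    rw [aeval_eq_eval] at hvP ⊢
    by_cases hi : v (Sum.inl i) = 0
    · simp [hi]
    by_cases hj : v (Sum.inr j) = 0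
    · simp [hj]
    have := h ⟨v, ⟨i, hi⟩, ⟨j, hj⟩⟩ hvP
    simp [this]
  rw [Ideal.mem_span_singleton, ← pow_one P] at h1
  simpa using hij.dvd_of_dvd_mul hP h1

lemma Form.mk_mem_zeroSet_iff {m : ℕ} (G : Form m) (v : Cone) :
    mk m v ∈ G.zeroSet ↔ eval v.1 G.1 = 0 :=
  ⟨fun ⟨_, hw, h0⟩ => (eval_eq_zero_iff_of_rel m G hw).1 h0, fun h => ⟨v, rfl, h⟩⟩

lemma Form.dvd_of_zeroSet_subset {m : ℕ} {P G : Form m} (hP : Irreducible P.1)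
    (h : P.zeroSet ⊆ G.zeroSet) : P.1 ∣ G.1 := by
  refine dvd_of_eval_eq_zero hP fun v hv => ?_
  exact (G.mk_mem_zeroSet_iff v).1 (h ⟨v, rfl, hv⟩)

lemma Form.zeroSet_subset_of_dvd {m : ℕ} {P G : Form m} (h : P.1 ∣ G.1) :
    P.zeroSet ⊆ G.zeroSet := by
  rintro _ ⟨v, rfl, hv⟩
  obtain ⟨Q, hQ⟩ := h
  exact ⟨v, rfl, by rw [hQ, map_mul, hv, zero_mul]⟩

lemma Form.isIrreducible_zeroSet {m : ℕ} {P : Form m} (hP : Irreducible P.1) :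
    IsIrreducible P.zeroSet := by
  have himg : P.zeroSet = mk m '' {v : Cone | eval v.1 P.1 = 0} := by
    rw [← P.preimage_zeroSet, Set.image_preimage_eq _ (mk_surjective m)]
  have key : ∀ G : MvPolynomial Var ℂ, ¬ P.1 ∣ G → ∃ v : Cone, eval v.1 P.1 = 0 ∧ eval v.1 G ≠ 0 :=
    fun G hG => by
      by_contra! hc
      exact hG (dvd_of_eval_eq_zero hP hc)
  rw [himg]
  refine IsIrreducible.image ⟨?_, ?_⟩ _ (continuous_mk m).continuousOn
  · obtain ⟨v, hv, -⟩ := key 1 hP.not_dvd_one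
    exact ⟨v, hv⟩
  · have basic : ∀ U : Set Cone, IsOpen U → ∀ v ∈ U, ∃ G : MvPolynomial Var ℂ, eval v.1 G ≠ 0 ∧
        ∀ w : Cone, eval w.1 G ≠ 0 → w ∈ U := by
      intro U hU v hv
      obtain ⟨O, hO, rfl⟩ := isOpen_induced_iff.mp hU
      obtain ⟨_, ⟨f, rfl⟩, hvf, hf⟩ :=
        PrimeSpectrum.isTopologicalBasis_basic_opens.exists_subset_of_mem_open hv hO
      refine ⟨f, ?_, fun w hw => hf ?_⟩
      · simpa [pointToPoint, aeval_eq_eval] using hvf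
      · simpa [pointToPoint, aeval_eq_eval] using hw
    rintro U V hU hV ⟨u, hu0, hu⟩ ⟨v, hv0, hv⟩
    obtain ⟨G, hG, hGU⟩ := basic U hU u hu
    obtain ⟨H, hH, hHV⟩ := basic V hV v hv
    have hdvd : ¬ P.1 ∣ G * H := by
      intro hd
      rcases hP.prime.dvd_or_dvd hd with ⟨Q, rfl⟩ | ⟨Q, rfl⟩
      · exact hG (by rw [map_mul, show eval u.1 P.1 = 0 from hu0, zero_mul])
      · exact hH (by rw [map_mul, show eval v.1 P.1 = 0 from hv0, zero_mul])
    obtain ⟨w, hw0, hw⟩ := key _ hdvd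
    rw [map_mul] at hw
    exact ⟨w, hw0, hGU w (left_ne_zero_of_mul hw), hHV w (right_ne_zero_of_mul hw)⟩

lemma exists_irreducible_form {m : ℕ} {Z : Set (Hirzebruch m)} (hZ : IsClosed Z)
    (hne : Z ≠ Set.univ) (hirr : IsIrreducible Z) :
    ∃ P : Form m, Irreducible P.1 ∧ Z ⊆ P.zeroSet := by
  obtain ⟨⟨G, hG0, hG⟩, hZG⟩ := exists_form_of_isClosed hZ hne
  induction G using WfDvdMonoid.induction_on_irreducible with
  | zero => exact absurd rfl hG0
  | unit u hu =>
    obtain ⟨P, hP⟩ := hirr.nonempty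
    obtain ⟨v, -, hv⟩ := hZG hP
    exact absurd hv (hu.map (eval v.1)).ne_zero
  | mul A B hA hB ih =>
    let FA : Form m := ⟨A, hA, exists_isWeightedHomogeneous_of_dvd m hG0 hG (dvd_mul_left _ _)⟩
    let FB : Form m :=
      ⟨B, hB.ne_zero, exists_isWeightedHomogeneous_of_dvd m hG0 hG (dvd_mul_right _ _)⟩
    have hsub : Z ⊆ FA.zeroSet ∪ FB.zeroSet := by
      intro P hP
      obtain ⟨v, rfl, hv⟩ := hZG hP
      rw [map_mul, mul_eq_zero] at hv
      rcases hv with hv | hv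
      · exact Or.inr ⟨v, rfl, hv⟩
      · exact Or.inl ⟨v, rfl, hv⟩
    rcases isPreirreducible_iff_isClosed_union_isClosed.1 hirr.isPreirreducible _ _
      FA.isClosed_zeroSet FB.isClosed_zeroSet hsub with h | h
    · exact ih FA.2.1 FA.2.2 h
    · exact ⟨FB, hB, h⟩

lemma zeroSet_eq_of_subset {m : ℕ} {P : Form m} (hP : Irreducible P.1) {Z : Set (Hirzebruch m)}
    (hZ : IsClosed Z) (hne : Z ≠ Set.univ) (hirr : IsIrreducible Z) (h : P.zeroSet ⊆ Z) :
    Z = P.zeroSet := by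
  obtain ⟨Q, hQ, hZQ⟩ := exists_irreducible_form hZ hne hirr
  have h1 := Form.dvd_of_zeroSet_subset hP (h.trans hZQ)
  have h2 := (hP.associated_of_dvd hQ h1).symm.dvd
  exact (hZQ.trans (Form.zeroSet_subset_of_dvd h2)).antisymm h

lemma coheight_univ_hirzebruch {m : ℕ} (T : TopologicalSpace.IrreducibleCloseds (Hirzebruch m))
    (hT : (T : Set (Hirzebruch m)) = Set.univ) : Order.coheight T = 0 := by
  rw [Order.coheight_eq_zero]
  intro S _
  change (S : Set (Hirzebruch m)) ⊆ T
  rw [hT]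
  exact Set.subset_univ _

/-- The prime divisor defined by an irreducible form. -/
def PrimeDivisor.ofForm {m : ℕ} (P : Form m) (hP : Irreducible P.1) : PrimeDivisor m :=
  ⟨⟨P.zeroSet, Form.isIrreducible_zeroSet hP, P.isClosed_zeroSet⟩, by
    refine le_antisymm ?_ ?_
    · refine Order.coheight_le_coe_iff.2 fun T hT => ?_
      rw [coheight_univ_hirzebruch T ?_]
      · simp
      · by_contra hne
        have hsub : P.zeroSet ⊆ (T : Set (Hirzebruch m)) := hT.le
        have := zeroSet_eq_of_subset hP T.isClosed hne T.isIrreducible hsub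
        exact hT.ne (TopologicalSpace.IrreducibleCloseds.ext this.symm)
    · rw [Order.one_le_iff_ne_zero, Order.coheight_ne_zero]
      intro hmax
      let E : TopologicalSpace.IrreducibleCloseds (Hirzebruch m) :=
        ⟨Set.univ, isIrreducible_univ_hirzebruch m, isClosed_univ⟩
      have : E ≤ _ := hmax (b := E) (fun x _ => trivial)
      exact P.zeroSet_ne_univ (Set.univ_subset_iff.1 this)⟩

lemma PrimeDivisor.ext_pts {m : ℕ} {Z W : PrimeDivisor m} (h : Z.pts = W.pts) : Z = W :=
  Subtype.ext (TopologicalSpace.IrreducibleCloseds.ext h)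

lemma PrimeDivisor.exists_eq_zeroSet {m : ℕ} (Z : PrimeDivisor m) :
    ∃ P : Form m, Irreducible P.1 ∧ Z.pts = P.zeroSet := by
  have hne : Z.pts ≠ Set.univ := fun h => by
    have := Z.2
    rw [coheight_univ_hirzebruch Z.1 h] at this
    exact zero_ne_one this
  obtain ⟨P, hP, hZP⟩ := exists_irreducible_form Z.1.isClosed hne Z.1.isIrreducible
  refine ⟨P, hP, ?_⟩
  by_contra hne'
  have hlt : Z.1 < (PrimeDivisor.ofForm P hP).1 :=
    lt_of_le_of_ne hZP fun h => hne' (congrArg (fun W => PrimeDivisor.pts W) (Subtype.ext h))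
  have h1 := Order.coheight_add_one_le hlt
  rw [(PrimeDivisor.ofForm P hP).2, Z.2] at h1
  norm_num at h1

/-- An irreducible form defining the prime divisor `Z`. -/
def PrimeDivisor.eqn {m : ℕ} (Z : PrimeDivisor m) : Form m := Z.exists_eq_zeroSet.choose

lemma PrimeDivisor.irreducible_eqn {m : ℕ} (Z : PrimeDivisor m) : Irreducible Z.eqn.1 :=
  Z.exists_eq_zeroSet.choose_spec.1

lemma PrimeDivisor.pts_eq {m : ℕ} (Z : PrimeDivisor m) : Z.pts = Z.eqn.zeroSet :=
  Z.exists_eq_zeroSet.choose_spec.2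

lemma PrimeDivisor.prime_eqn {m : ℕ} (Z : PrimeDivisor m) : Prime Z.eqn.1 :=
  Z.irreducible_eqn.prime

lemma PrimeDivisor.associated_eqn {m : ℕ} {Z : PrimeDivisor m} {P : Form m}
    (hP : Irreducible P.1) (h : Z.pts = P.zeroSet) : Associated Z.eqn.1 P.1 :=
  Z.irreducible_eqn.associated_of_dvd hP
    (Form.dvd_of_zeroSet_subset Z.irreducible_eqn (by rw [← Z.pts_eq, h]))

lemma PrimeDivisor.associated_eqn_ofForm {m : ℕ} {P : Form m} (hP : Irreducible P.1) :
    Associated (PrimeDivisor.ofForm P hP).eqn.1 P.1 :=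
  PrimeDivisor.associated_eqn hP rfl

lemma PrimeDivisor.eq_of_eqn_dvd {m : ℕ} {Z W : PrimeDivisor m} (h : Z.eqn.1 ∣ W.eqn.1) :
    Z = W := by
  have h1 := (Z.irreducible_eqn.associated_of_dvd W.irreducible_eqn h).symm.dvd
  refine PrimeDivisor.ext_pts ?_
  rw [Z.pts_eq, W.pts_eq]
  exact (Form.zeroSet_subset_of_dvd h).antisymm (Form.zeroSet_subset_of_dvd h1)

/-- On each chart, the ideal of a prime divisor is generated by the dehomogenization of its
equation. -/
lemma PrimeDivisor.ideal_eq {m : ℕ} (Z : PrimeDivisor m) (i j : Fin 2) :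
    Z.ideal i j = Ideal.span {dehom i j Z.eqn.1} := by
  obtain ⟨d, hd⟩ := Z.eqn.2.2
  have hmem : ∀ q, q ∈ chart m i j ⁻¹' Z.pts ↔ eval q (dehom i j Z.eqn.1) = 0 := fun q => by
    rw [Set.mem_preimage, Z.pts_eq, chart_mem_zeroSet_iff]
  ext h
  rw [PrimeDivisor.ideal, mem_vanishingIdeal_iff, Ideal.mem_span_singleton]
  constructor
  · intro hv
    obtain ⟨H, d', hH, rfl⟩ := exists_dehom_eq m i j h
    refine (dehom_dvd_dehom_iff hd hH).2 ⟨1, 1, dvd_of_eval_eq_zero Z.irreducible_eqn ?_⟩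
    intro v hvP
    by_cases hi : v.1 (Sum.inl i) = 0
    · simp [hi]
    by_cases hj : v.1 (Sum.inr j) = 0
    · simp [hj]
    obtain ⟨q, hq⟩ := exists_chart_eq_mk m hi hj
    have hqZ : chart m i j q ∈ Z.pts := by
      rw [hq, Z.pts_eq]
      exact ⟨v, rfl, hvP⟩
    have h0 := hv q hqZ
    rw [aeval_eq_eval] at h0
    rw [map_mul]
    by_cases hH0 : H = 0
    · simp [hH0]
    let FH : Form m := ⟨H, hH0, d', hH⟩
    have h1 : chart m i j q ∈ FH.zeroSet := (chart_mem_zeroSet_iff FH i j q).2 h0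
    rw [hq, FH.mk_mem_zeroSet_iff] at h1
    rw [show eval v.1 H = 0 from h1, zero_mul]
  · rintro ⟨k, rfl⟩ q hq
    rw [aeval_eq_eval, map_mul, (hmem q).1 hq, zero_mul]

lemma ordAt_span_singleton {A : Type*} [CommRing A] (p h : A) :
    ordAt (Ideal.span {p}) h = emultiplicity p h := by
  rw [ordAt]
  simp only [Ideal.span_singleton_pow, Ideal.mem_span_singleton]
  refine le_antisymm (iSup₂_le fun n hn => le_emultiplicity_of_pow_dvd hn) ?_
  refine ENat.forall_natCast_le_iff_le.1 fun n hn => ?_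
  exact le_iSup₂_of_le n (pow_dvd_of_le_emultiplicity hn) le_rfl

lemma PrimeDivisor.ordAt_ideal {m : ℕ} (Z : PrimeDivisor m) (i j : Fin 2)
    (h : MvPolynomial (Fin 2) ℂ) :
    ordAt (Z.ideal i j) h = emultiplicity (dehom i j Z.eqn.1) h := by
  rw [Z.ideal_eq, ordAt_span_singleton]

lemma PrimeDivisor.emultiplicity_dehom {m : ℕ} (Z : PrimeDivisor m) {i j : Fin 2}
    (h : MeetsChart Z.eqn.1 i j) (G : Form m) :
    emultiplicity (dehom i j Z.eqn.1) (dehom i j G.1) = emultiplicity Z.eqn.1 G.1 := by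
  obtain ⟨d, hd⟩ := Z.eqn.2.2
  obtain ⟨d', hd'⟩ := G.2.2
  exact emultiplicity_eq_emultiplicity_iff.2 fun n =>
    h.pow_dehom_dvd_iff Z.irreducible_eqn hd hd' n

lemma PrimeDivisor.meetsChart_iff {m : ℕ} (Z : PrimeDivisor m) (i j : Fin 2) :
    (chart m i j ⁻¹' Z.pts).Nonempty ↔ MeetsChart Z.eqn.1 i j := by
  have h := Z.ideal_eq i j
  rw [PrimeDivisor.ideal] at h
  constructor
  · rintro ⟨q, hq⟩
    by_contra hn
    rw [Ideal.span_singleton_eq_top.2 (isUnit_dehom_of_not_meetsChart hn)] at h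
    have h1 : (1 : MvPolynomial (Fin 2) ℂ) ∈ vanishingIdeal ℂ (chart m i j ⁻¹' Z.pts) := by
      rw [h]
      trivial
    simpa using h1 q hq
  · intro hm
    by_contra hn
    rw [Set.not_nonempty_iff_eq_empty.1 hn, vanishingIdeal_empty] at h
    obtain ⟨d, hd⟩ := Z.eqn.2.2
    exact (hm.prime_dehom Z.irreducible_eqn hd).not_isUnit (Ideal.span_singleton_eq_top.1 h.symm)

/-- The order of a form along a prime divisor is the multiplicity of the equation of the divisor
in the form. -/
lemma Form.ord_eq {m : ℕ} (G : Form m) (Z : PrimeDivisor m) :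
    (G.ord Z : ℕ∞) = emultiplicity Z.eqn.1 G.1 := by
  have h1 : (⨅ (i : Fin 2) (j : Fin 2), ordAt (Z.ideal i j) (dehom i j G.1))
      = emultiplicity Z.eqn.1 G.1 := by
    refine le_antisymm ?_ (le_iInf₂ fun i j => ?_)
    · obtain ⟨i, j, hij⟩ := exists_meetsChart Z.irreducible_eqn
      refine iInf₂_le_of_le i j ?_
      rw [Z.ordAt_ideal, Z.emultiplicity_dehom hij]
    · rw [Z.ordAt_ideal]
      by_cases hij : MeetsChart Z.eqn.1 i j
      · rw [Z.emultiplicity_dehom hij]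
      · rw [emultiplicity_eq_top.2 (FiniteMultiplicity.not_of_isUnit_left _
          (isUnit_dehom_of_not_meetsChart hij))]
        exact le_top
  rw [Form.ord, h1, ENat.natCast_toNat]
  exact finiteMultiplicity_iff_emultiplicity_ne_top.1
    (FiniteMultiplicity.of_not_isUnit Z.irreducible_eqn.not_isUnit G.2.1)

/-! ### Effective divisors and forms -/

lemma Form.div_apply {m : ℕ} (G : Form m) (Z : PrimeDivisor m) : G.div Z = (G.ord Z : ℤ) := rfl

lemma Form.div_nonneg {m : ℕ} (G : Form m) : 0 ≤ G.div := fun Z => by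
  rw [G.div_apply]
  exact Int.natCast_nonneg _

lemma Form.emultiplicity_eqn {m : ℕ} (G : Form m) (Z : PrimeDivisor m) :
    emultiplicity Z.eqn.1 G.1 = ((G.div Z).toNat : ℕ∞) := by
  rw [G.div_apply, Int.toNat_natCast, G.ord_eq]

lemma Form.dvd_iff_div_le {m : ℕ} {P G : Form m} : P.1 ∣ G.1 ↔ P.div ≤ G.div := by
  rw [UniqueFactorizationMonoid.dvd_iff_emultiplicity_le P.2.1]
  have key : ∀ Z : PrimeDivisor m, emultiplicity Z.eqn.1 P.1 ≤ emultiplicity Z.eqn.1 G.1 ↔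
      P.div Z ≤ G.div Z := fun Z => by
    rw [← P.ord_eq, ← G.ord_eq, P.div_apply, G.div_apply, Nat.cast_le, Nat.cast_le]
  constructor
  · exact fun h Z => (key Z).1 (h _ Z.prime_eqn)
  · intro h p hp
    by_cases hpP : p ∣ P.1
    · let Fp : Form m := ⟨p, hp.ne_zero, exists_isWeightedHomogeneous_of_dvd m P.2.1 P.2.2 hpP⟩
      have h1 : Associated (PrimeDivisor.ofForm Fp hp.irreducible).eqn.1 p :=
        PrimeDivisor.associated_eqn_ofForm (P := Fp) hp.irreducible
      rw [emultiplicity_eq_of_associated_left h1, emultiplicity_eq_of_associated_left h1, key]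
      exact h _
    · rw [emultiplicity_eq_zero.2 hpP]
      exact zero_le

lemma Form.associated_iff {m : ℕ} {P G : Form m} : Associated P.1 G.1 ↔ P.div = G.div := by
  rw [← dvd_dvd_iff_associated, Form.dvd_iff_div_le, Form.dvd_iff_div_le, le_antisymm_iff]

/-- The product of two forms. -/
def Form.mul {m : ℕ} (G H : Form m) : Form m :=
  ⟨G.1 * H.1, mul_ne_zero G.2.1 H.2.1, by
    obtain ⟨d, hd⟩ := G.2.2
    obtain ⟨d', hd'⟩ := H.2.2
    exact ⟨d + d', hd.mul hd'⟩⟩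

lemma Form.div_mul {m : ℕ} (G H : Form m) : (G.mul H).div = G.div + H.div := by
  ext Z
  rw [Finsupp.add_apply, Form.div_apply, Form.div_apply, Form.div_apply]
  have h : ((G.mul H).ord Z : ℕ∞) = ((G.ord Z + H.ord Z : ℕ) : ℕ∞) := by
    rw [Nat.cast_add, Form.ord_eq, Form.ord_eq, Form.ord_eq]
    exact emultiplicity_mul Z.prime_eqn
  exact_mod_cast h

/-- The powers of a form. -/
def Form.pow {m : ℕ} (G : Form m) (n : ℕ) : Form m :=
  ⟨G.1 ^ n, pow_ne_zero n G.2.1, by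
    obtain ⟨d, hd⟩ := G.2.2
    exact ⟨n • d, hd.pow n⟩⟩

lemma Form.div_pow {m : ℕ} (G : Form m) (n : ℕ) : (G.pow n).div = n • G.div := by
  ext Z
  rw [Finsupp.smul_apply, Form.div_apply, Form.div_apply]
  have h : ((G.pow n).ord Z : ℕ∞) = ((n * G.ord Z : ℕ) : ℕ∞) := by
    rw [Nat.cast_mul, Form.ord_eq, Form.ord_eq]
    exact emultiplicity_pow Z.prime_eqn
  rw [nsmul_eq_mul]
  exact_mod_cast h

lemma PrimeDivisor.div_eqn {m : ℕ} (Z : PrimeDivisor m) :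
    Z.eqn.div = Finsupp.single Z 1 := by
  classical
  ext W
  rw [Form.div_apply, Finsupp.single_apply]
  have h : (Z.eqn.ord W : ℕ∞) = ((if Z = W then 1 else 0 : ℕ) : ℕ∞) := by
    rw [Form.ord_eq]
    split_ifs with hZW
    · subst hZW
      rw [Nat.cast_one]
      simpa using emultiplicity_pow_self_of_prime Z.prime_eqn 1
    · rw [Nat.cast_zero, emultiplicity_eq_zero]
      exact fun hd => hZW (PrimeDivisor.eq_of_eqn_dvd hd).symm
  have h' : Z.eqn.ord W = if Z = W then 1 else 0 := by exact_mod_cast h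
  rw [h']
  split_ifs <;> rfl

/-- Every effective divisor is the divisor of a form. -/
lemma exists_div_eq {m : ℕ} {D : Divisor m} (hD : 0 ≤ D) : ∃ G : Form m, G.div = D := by
  induction D using Finsupp.induction with
  | zero =>
    let F₁ : Form m := ⟨1, one_ne_zero, 0, isWeightedHomogeneous_one _ _⟩
    refine ⟨F₁, ?_⟩
    ext Z
    have h : (F₁.ord Z : ℕ∞) = (0 : ℕ) := by
      rw [Form.ord_eq, Nat.cast_zero, emultiplicity_eq_zero]
      exact Z.irreducible_eqn.not_dvd_one
    rw [Form.div_apply, Nat.cast_inj.1 h]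
    rfl
  | single_add Z n D hZ hn ih =>
    have hn0 : 0 ≤ n := by
      have := hD Z
      simpa [Finsupp.notMem_support_iff.1 hZ] using this
    have hD0 : 0 ≤ D := fun W => by
      by_cases h : Z = W
      · rw [← h, Finsupp.notMem_support_iff.1 hZ]
        rfl
      · have := hD W
        simpa [Finsupp.single_apply, h] using this
    obtain ⟨G, hG⟩ := ih hD0
    refine ⟨(Z.eqn.pow n.toNat).mul G, ?_⟩
    rw [Form.div_mul, Form.div_pow, hG, Z.div_eqn, Finsupp.smul_single, nsmul_one,
      Int.natCast_toNat_eq_self.2 hn0]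

/-- An effective divisor in the class of `a S₊` is the divisor of a form of degree `(a, 0)`. -/
lemma exists_div_eq_of_linEquiv {m a : ℕ} {D : Divisor m} (hD : 0 ≤ D)
    (h : LinEquiv D (a • sPlus m)) :
    ∃ G : Form m, G.1.IsWeightedHomogeneous (wt m) ((a : ℤ), (0 : ℤ)) ∧ G.div = D := by
  obtain ⟨P, Q, ⟨d, hP, hQ⟩, hPQ⟩ := h
  obtain ⟨G, rfl⟩ := exists_div_eq hD
  refine ⟨G, ?_, rfl⟩
  have h1 : (G.mul Q).div = (P.mul ((Form.var m (Sum.inl 0)).pow a)).div := by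
    rw [Form.div_mul, Form.div_mul, Form.div_pow, ← sub_eq_zero]
    rw [sPlus] at hPQ
    rw [← sub_eq_zero] at hPQ
    rw [← hPQ]
    abel
  have hass : Associated (G.1 * Q.1) (P.1 * X (Sum.inl 0) ^ a) :=
    (Form.associated_iff (P := G.mul Q) (G := P.mul ((Form.var m (Sum.inl 0)).pow a))).2 h1
  obtain ⟨e, he⟩ := G.2.2
  have hdeg : (G.1 * Q.1).IsWeightedHomogeneous (wt m) (d + ((a : ℤ), (0 : ℤ))) := by
    obtain ⟨u, hu⟩ := hass.symm
    have hPX := hP.mul ((isWeightedHomogeneous_X ℂ (wt m) (Sum.inl 0)).pow a)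
    obtain ⟨c, -, hc⟩ := MvPolynomial.isUnit_iff_eq_C_of_isReduced.1 u.isUnit
    rw [← hu, hc, mul_comm]
    have := hPX.C_mul c
    convert this using 1
    simp [wt]
  have h2 := IsWeightedHomogeneous.inj_right (mul_ne_zero G.2.1 Q.2.1) hdeg (he.mul hQ)
  have h3 : e = ((a : ℤ), (0 : ℤ)) := by
    rw [add_comm] at h2
    exact (add_right_cancel h2).symm
  rwa [← h3]

lemma linEquiv_div {m a : ℕ} {G : Form m}
    (hG : G.1.IsWeightedHomogeneous (wt m) ((a : ℤ), (0 : ℤ))) :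
    LinEquiv G.div (a • sPlus m) := by
  refine ⟨G, (Form.var m (Sum.inl 0)).pow a, ⟨_, hG, ?_⟩, by rw [Form.div_pow]; rfl⟩
  have h := (isWeightedHomogeneous_X ℂ (wt m) (Sum.inl 0)).pow a
  have hw : a • wt m (Sum.inl 0) = ((a : ℤ), (0 : ℤ)) := by simp [wt]
  rwa [hw] at h

/-- In each chart, the ideal of the divisor of a form is generated by the dehomogenization of the
form. -/
lemma divisorIdeal_div {m : ℕ} (G : Form m) (i j : Fin 2) :
    divisorIdeal G.div i j = Ideal.span {dehom i j G.1} := by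
  obtain ⟨d, hd⟩ := G.2.2
  ext h
  simp only [divisorIdeal, Submodule.mem_iInf, PrimeDivisor.ideal_eq, Ideal.span_singleton_pow,
    Ideal.mem_span_singleton]
  constructor
  · intro hh
    obtain ⟨H, d', hH, rfl⟩ := exists_dehom_eq m i j h
    by_cases hH0 : H = 0
    · rw [hH0, map_zero]
      exact dvd_zero _
    -- The exponent `n` of `x_i` and `y_j` below is at least every multiplicity in the divisor of `G`,
    -- so the prime divisors outside the chart impose no further condition.
    obtain ⟨n, hn⟩ : ∃ n : ℕ, ∀ Z, G.ord Z ≤ n := by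
      obtain ⟨n, hn⟩ := (G.finite_ord_ne_zero.image G.ord).bddAbove
      refine ⟨n, fun Z => ?_⟩
      by_cases h0 : G.ord Z = 0
      · rw [h0]
        exact Nat.zero_le _
      · exact hn ⟨Z, h0, rfl⟩
    refine (dehom_dvd_dehom_iff hd hH).2 ⟨n, n, ?_⟩
    let FH : Form m := Form.mul ⟨H, hH0, d', hH⟩
      (((Form.var m (Sum.inl i)).pow n).mul ((Form.var m (Sum.inr j)).pow n))
    change G.1 ∣ FH.1
    rw [Form.dvd_iff_div_le]
    intro Z
    rw [Form.div_apply, Form.div_apply, Nat.cast_le, ← Nat.cast_le (α := ℕ∞), FH.ord_eq,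
      ← pow_dvd_iff_le_emultiplicity]
    by_cases hij : MeetsChart Z.eqn.1 i j
    · obtain ⟨dZ, hdZ⟩ := Z.eqn.2.2
      exact ((hij.pow_dehom_dvd_iff Z.irreducible_eqn hdZ hH _).1 (hh Z)).mul_right _
    · refine (pow_dvd_pow _ (hn Z)).trans (Dvd.dvd.mul_left ?_ _)
      rw [MeetsChart, not_and_or, not_not, not_not] at hij
      rcases hij with hij | hij
      · exact (pow_dvd_pow_of_dvd hij n).mul_right _
      · exact (pow_dvd_pow_of_dvd hij n).mul_left _
  · intro hh Z
    rw [← map_pow]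
    refine (map_dvd _ ?_).trans hh
    rw [pow_dvd_iff_le_emultiplicity, G.emultiplicity_eqn]

/-- Every prime of the coordinate ring of a chart comes from a prime divisor meeting the chart. -/
lemma exists_primeDivisor_of_prime (m : ℕ) (i j : Fin 2) {p : MvPolynomial (Fin 2) ℂ}
    (hp : Prime p) : ∃ Z : PrimeDivisor m, MeetsChart Z.eqn.1 i j ∧
      Associated (dehom i j Z.eqn.1) p := by
  obtain ⟨H, d, hH, hHp⟩ := exists_dehom_eq m i j p
  have hH0 : H ≠ 0 := by
    rintro rfl
    rw [map_zero] at hHp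
    exact hp.ne_zero hHp.symm
  have hHu : ∃ q, Irreducible q ∧ q ∣ H ∧ p ∣ dehom i j q := by
    have hdvd : p ∣ dehom i j H := by rw [hHp]
    clear hHp hH
    induction H using WfDvdMonoid.induction_on_irreducible with
    | zero => exact absurd rfl hH0
    | unit u hu => exact absurd (isUnit_of_dvd_unit hdvd (hu.map (dehom i j))) hp.not_isUnit
    | mul A B hA hB ih =>
      rw [map_mul] at hdvd
      rcases hp.dvd_or_dvd hdvd with h | h
      · exact ⟨B, hB, dvd_mul_right _ _, h⟩
      · obtain ⟨q, hq, hqA, hqp⟩ := ih hA h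
        exact ⟨q, hq, hqA.mul_left _, hqp⟩
  obtain ⟨q, hq, hqH, hpq⟩ := hHu
  have hqd := exists_isWeightedHomogeneous_of_dvd m hH0 ⟨d, hH⟩ hqH
  let Fq : Form m := ⟨q, hq.ne_zero, hqd⟩
  obtain ⟨u, hu⟩ := PrimeDivisor.associated_eqn_ofForm (P := Fq) hq
  have hass : Associated (dehom i j (PrimeDivisor.ofForm Fq hq).eqn.1) (dehom i j q) := by
    refine ⟨Units.map (dehom i j).toMonoidHom u, ?_⟩
    change _ * dehom i j u.1 = _
    rw [← map_mul, hu]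
  have hqp : Associated (dehom i j q) p :=
    associated_of_dvd_dvd (by rw [← hHp]; exact map_dvd _ hqH) hpq
  refine ⟨PrimeDivisor.ofForm Fq hq, ?_, hass.trans hqp⟩
  by_contra hn
  exact hp.not_isUnit ((hass.trans hqp).isUnit (isUnit_dehom_of_not_meetsChart hn))

/-- The divisor of a form restricts to the divisor of `F` on the affine plane exactly if `F` agrees
with the dehomogenization of the form up to a constant. -/
lemma restrictsTo_div_iff {m : ℕ} (G : Form m) {F : MvPolynomial (Fin 2) ℂ} (hF : F ≠ 0) :
    RestrictsTo G.div F ↔ Associated (dehom 1 1 G.1) F := by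
  have key : RestrictsTo G.div F ↔ ∀ Z : PrimeDivisor m, MeetsChart Z.eqn.1 1 1 →
      emultiplicity (dehom 1 1 Z.eqn.1) (dehom 1 1 G.1)
        = emultiplicity (dehom 1 1 Z.eqn.1) F := by
    refine forall_congr' fun Z => ?_
    rw [Z.meetsChart_iff, Z.ordAt_ideal]
    refine imp_congr_right fun hZ => ?_
    rw [Z.emultiplicity_dehom hZ, G.emultiplicity_eqn]
  rw [key]
  constructor
  · intro h
    have h1 : ∀ p : MvPolynomial (Fin 2) ℂ, Prime p →
        emultiplicity p (dehom 1 1 G.1) = emultiplicity p F := by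
      intro p hp
      obtain ⟨Z, hZ, hZp⟩ := exists_primeDivisor_of_prime m 1 1 hp
      rw [emultiplicity_eq_of_associated_left hZp, emultiplicity_eq_of_associated_left hZp]
      exact h Z hZ
    refine associated_of_dvd_dvd ?_ ?_
    · exact (UniqueFactorizationMonoid.dvd_iff_emultiplicity_le (G.dehom_ne_zero 1 1)).2
        fun p hp => (h1 p hp).le
    · exact (UniqueFactorizationMonoid.dvd_iff_emultiplicity_le hF).2 fun p hp => (h1 p hp).ge
  · exact fun h Z _ => emultiplicity_eq_of_associated_right h

lemma associated_iff_exists_smul {σ : Type*} {F F' : MvPolynomial σ ℂ} :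
    Associated F F' ↔ ∃ c : ℂ, c ≠ 0 ∧ F' = c • F := by
  constructor
  · rintro ⟨u, rfl⟩
    obtain ⟨c, hc, hu⟩ := MvPolynomial.isUnit_iff_eq_C_of_isReduced.1 u.isUnit
    exact ⟨c, hc.ne_zero, by rw [hu, mul_comm, C_mul']⟩
  · rintro ⟨c, hc, rfl⟩
    rw [← C_mul', mul_comm]
    exact (associated_mul_unit_right F _ ((isUnit_iff_ne_zero.2 hc).map C))

lemma isComponent_div_iff {m : ℕ} (P G : Form m) (hP : Irreducible P.1) :
    IsComponent P G.div ↔ P.1 ∣ G.1 := by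
  have key : ∀ Z : PrimeDivisor m, Z.pts = P.zeroSet → (G.div Z ≠ 0 ↔ P.1 ∣ G.1) := fun Z hZ => by
    have h1 := PrimeDivisor.associated_eqn hP hZ
    rw [← h1.dvd_iff_dvd_left, ← not_iff_not, not_not, ← emultiplicity_eq_zero, ← G.ord_eq,
      G.div_apply]
    norm_cast
  constructor
  · rintro ⟨Z, hZ, h⟩
    exact (key Z hZ).1 h
  · exact fun h => ⟨PrimeDivisor.ofForm P hP, rfl, (key (PrimeDivisor.ofForm P hP) rfl).2 h⟩

/-! ### Newton triangles and homogenization -/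

lemma mem_triangle_iff {a b : ℝ} (ha : 0 < a) (hb : 0 < b) (p : ℝ × ℝ) :
    p ∈ convexHull ℝ {(a, (0 : ℝ)), (0, 0), (0, b)} ↔
      0 ≤ p.1 ∧ 0 ≤ p.2 ∧ b * p.1 + a * p.2 ≤ a * b := by
  have hconv : Convex ℝ {p : ℝ × ℝ | 0 ≤ p.1 ∧ 0 ≤ p.2 ∧ b * p.1 + a * p.2 ≤ a * b} := by
    rintro x ⟨hx1, hx2, hx3⟩ y ⟨hy1, hy2, hy3⟩ s t hs ht hst
    refine ⟨?_, ?_, ?_⟩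
    · simp only [Prod.fst_add, Prod.smul_fst, smul_eq_mul]
      positivity
    · simp only [Prod.snd_add, Prod.smul_snd, smul_eq_mul]
      positivity
    · simp only [Prod.fst_add, Prod.smul_fst, Prod.snd_add, Prod.smul_snd, smul_eq_mul]
      have h1 := mul_le_mul_of_nonneg_left hx3 hs
      have h2 := mul_le_mul_of_nonneg_left hy3 ht
      have h3 : s * (a * b) + t * (a * b) = a * b := by rw [← add_mul, hst, one_mul]
      linarith
  constructor
  · intro hp
    refine convexHull_min ?_ hconv hp
    rintro _ (rfl | rfl | rfl)
    · exact ⟨ha.le, le_rfl, by simp [mul_comm]⟩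
    · exact ⟨le_rfl, le_rfl, by simp; positivity⟩
    · exact ⟨le_rfl, hb.le, by simp⟩
  · rintro ⟨h1, h2, h3⟩
    set T : Set (ℝ × ℝ) := {(a, (0 : ℝ)), (0, 0), (0, b)}
    have key := (convex_convexHull ℝ T).sum_mem (t := Finset.univ)
      (w := ![p.1 / a, 1 - p.1 / a - p.2 / b, p.2 / b]) (z := ![(a, (0 : ℝ)), (0, 0), (0, b)])
      ?_ ?_ ?_
    · convert key using 1
      ext
      · simp [Fin.sum_univ_three, ha.ne']
      · simp [Fin.sum_univ_three, hb.ne']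
    · have h4 : 0 ≤ 1 - p.1 / a - p.2 / b := by
        have : 1 - p.1 / a - p.2 / b = (a * b - (b * p.1 + a * p.2)) / (a * b) := by
          field_simp
          ring
        rw [this]
        exact div_nonneg (by linarith) (by positivity)
      intro i _
      fin_cases i
      · exact div_nonneg h1 ha.le
      · exact h4
      · exact div_nonneg h2 hb.le
    · simp only [Fin.sum_univ_three, Matrix.cons_val]
      ring
    · intro i _
      refine subset_convexHull ℝ T ?_
      fin_cases i <;> simp [T]

lemma hasBidegree_iff {F : MvPolynomial (Fin 2) ℂ} {a b : ℕ} (ha : 0 < a) (hb : 0 < b) :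
    HasBidegree F a b ↔ F ≠ 0 ∧ ∀ e, coeff e F ≠ 0 → b * e 0 + a * e 1 ≤ a * b := by
  refine and_congr_right fun _ => ?_
  rw [newtonPolygon, (convex_convexHull ℝ _).convexHull_subset_iff, Set.image_subset_iff]
  refine forall_congr' fun e => ?_
  rw [Finset.mem_coe, mem_support_iff, Set.mem_preimage,
    mem_triangle_iff (Nat.cast_pos.2 ha) (Nat.cast_pos.2 hb)]
  refine imp_congr_right fun _ => ?_
  have h0 : (0 : ℝ) ≤ e 0 := Nat.cast_nonneg _
  have h1 : (0 : ℝ) ≤ e 1 := Nat.cast_nonneg _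
  simp only [h0, h1, true_and]
  norm_cast

/-- The lattice point `(i, j)` satisfies `(am - r) i + a j ≤ a (am - r)` exactly if the exponent
`m (a - i) - j` of `y₁` in the homogenization of `x ^ i * y ^ j` is at least
`⌈r (a - i) / a⌉ = r - ⌊i r / a⌋`. -/
lemma bidegree_bound_iff {a m r i j : ℕ} (hm : 1 ≤ m) (hr : r < a) :
    (a * m - r) * i + a * j ≤ a * (a * m - r) ↔
      i ≤ a ∧ j + (r - i * r / a) ≤ m * (a - i) := by
  have ha : 0 < a := by omega
  obtain ⟨B, hB⟩ : ∃ B, a * m = B + r := ⟨a * m - r, by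
    have : r ≤ a * m := by nlinarith
    omega⟩
  have hB0 : 0 < B := by nlinarith
  rw [hB, Nat.add_sub_cancel]
  constructor
  · intro h
    have hia : i ≤ a := by
      by_contra hc
      push Not at hc
      nlinarith
    refine ⟨hia, ?_⟩
    obtain ⟨s, rfl⟩ := Nat.exists_eq_add_of_le hia
    rw [Nat.add_sub_cancel_left]
    set q := i * r / (i + s) with hq
    have h1 : i * r < (i + s) * (q + 1) := by
      have := Nat.lt_mul_div_succ (i * r) ha
      rwa [← hq] at this
    have h2 : (i + s) * j + r * s ≤ (i + s) * (m * s) := by nlinarith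
    have h3 : (i + s) * (j + r) < (i + s) * (m * s + q + 1) := by nlinarith
    have h4 := lt_of_mul_lt_mul_left h3 (Nat.zero_le _)
    rcases le_total r q with h5 | h5
    · rw [Nat.sub_eq_zero_of_le h5]
      have : (i + s) * j ≤ (i + s) * (m * s) := by nlinarith
      exact le_of_mul_le_mul_left this ha
    · omega
  · rintro ⟨hia, h⟩
    obtain ⟨s, rfl⟩ := Nat.exists_eq_add_of_le hia
    rw [Nat.add_sub_cancel_left] at h
    set q := i * r / (i + s) with hq
    have h1 : (i + s) * q ≤ i * r := Nat.mul_div_le _ _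
    have h2 : j + r ≤ m * s + q := by omega
    nlinarith

/-- The exponent of the monomial `y_{1-j} ^ k * y_j ^ l`. -/
def expo (j : Fin 2) (k l : ℕ) : Fin 2 →₀ ℕ := Finsupp.single (1 - j) k + Finsupp.single j l

lemma expo_apply_same (j : Fin 2) (k l : ℕ) : expo j k l j = l := by
  fin_cases j <;> simp [expo]

lemma expo_apply_sub (j : Fin 2) (k l : ℕ) : expo j k l (1 - j) = k := by
  fin_cases j <;> simp [expo]

lemma eq_expo (j : Fin 2) (d : Fin 2 →₀ ℕ) : d = expo j (d (1 - j)) (d j) := by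
  ext k
  fin_cases j <;> fin_cases k <;> simp [expo]

lemma eq_expo_of_isHomogeneous {p : MvPolynomial (Fin 2) ℂ} {n : ℕ} (hp : p.IsHomogeneous n)
    {d : Fin 2 →₀ ℕ} (hd : coeff d p ≠ 0) (j : Fin 2) :
    d (1 - j) ≤ n ∧ d = expo j (d (1 - j)) (n - d (1 - j)) := by
  have h := hp hd
  rw [Finsupp.weight_apply, Finsupp.sum_fintype _ _ (by simp), Fin.sum_univ_two] at h
  simp only [Pi.one_apply, smul_eq_mul, mul_one] at h
  have h' : d (1 - j) + d j = n := by
    fin_cases j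
    · exact (add_comm _ _).trans h
    · exact h
  refine ⟨by omega, ?_⟩
  conv_lhs => rw [eq_expo j d]
  congr 1
  omega

lemma coeff_X_pow_mul_aeval {p : MvPolynomial (Fin 2) ℂ} {n : ℕ} (hp : p.IsHomogeneous n)
    (i : ℕ) (j : Fin 2) (e : Fin 2 →₀ ℕ) :
    coeff e (X 0 ^ i * aeval (fun k => if k = j then 1 else (X 1 : MvPolynomial (Fin 2) ℂ)) p)
      = if e 0 = i ∧ e 1 ≤ n then coeff (expo j (e 1) (n - e 1)) p else 0 := by
  classical
  have hmon : ∀ d c, X 0 ^ i * aeval (fun k => if k = j then 1 else (X 1 : MvPolynomial (Fin 2) ℂ))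
      (monomial d c) = monomial (expo 1 i (d (1 - j))) c := fun d c => by
    rw [aeval_monomial, Finsupp.prod_fintype _ _ (by simp), Fin.prod_univ_two, expo]
    have : (if (0 : Fin 2) = j then 1 else (X 1 : MvPolynomial (Fin 2) ℂ)) ^ d 0 *
        (if (1 : Fin 2) = j then 1 else X 1) ^ d 1 = X 1 ^ d (1 - j) := by
      fin_cases j <;> simp
    rw [this, algebraMap_eq, X_pow_eq_monomial, X_pow_eq_monomial, C_mul_monomial,
      monomial_mul, one_mul, mul_one]
    rfl
  conv_lhs => rw [p.as_sum, map_sum, Finset.mul_sum, coeff_sum]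
  simp only [hmon, coeff_monomial]
  have he : ∀ d : Fin 2 →₀ ℕ, expo 1 i (d (1 - j)) = e ↔ e 0 = i ∧ e 1 = d (1 - j) := fun d => by
    constructor
    · rintro rfl
      exact ⟨expo_apply_sub 1 _ _, expo_apply_same 1 _ _⟩
    · rintro ⟨rfl, h⟩
      rw [← h]
      exact (eq_expo 1 e).symm
  simp only [he]
  split_ifs with h
  · rw [Finset.sum_eq_single (expo j (e 1) (n - e 1))]
    · rw [if_pos ⟨h.1, (expo_apply_sub _ _ _).symm⟩]
    · intro d hd hne
      refine if_neg fun hc => hne ?_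
      rw [hc.2]
      exact (eq_expo_of_isHomogeneous hp (mem_support_iff.1 hd) j).2
    · intro hn
      rw [notMem_support_iff.1 hn, ite_self]
  · refine Finset.sum_eq_zero fun d hd => if_neg fun hc => h ⟨hc.1, ?_⟩
    rw [hc.2]
    exact (eq_expo_of_isHomogeneous hp (mem_support_iff.1 hd) j).1

/-- The coefficients of `∑ x₀ⁱ x₁^(a-i) g_i(y₀, y₁)` in the chart `x₁ = 1`, `y_j = 1`. -/
lemma coeff_dehom_formSum {a m : ℕ} {g : ℕ → MvPolynomial (Fin 2) ℂ}
    (hg : ∀ i ≤ a, (g i).IsHomogeneous (m * (a - i))) (j : Fin 2) (e : Fin 2 →₀ ℕ) :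
    coeff e (dehom 1 j (formSum a g)) = if e 0 ≤ a ∧ e 1 ≤ m * (a - e 0) then
      coeff (expo j (e 1) (m * (a - e 0) - e 1)) (g (e 0)) else 0 := by
  have hterm : ∀ i, dehom 1 j (X (Sum.inl 0) ^ i * X (Sum.inl 1) ^ (a - i) *
      rename Sum.inr (g i)) = X 0 ^ i *
        aeval (fun k => if k = j then 1 else (X 1 : MvPolynomial (Fin 2) ℂ)) (g i) := fun i => by
    rw [map_mul, map_mul, map_pow, map_pow, dehom_X_inl, one_pow, mul_one]
    congr 1
    · simp [dehom]
    · rw [dehom, aeval_rename]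
      rfl
  rw [formSum, map_sum, coeff_sum, Finset.sum_congr rfl fun i hi => by
    rw [hterm i, coeff_X_pow_mul_aeval (hg i (Nat.lt_succ_iff.1 (Finset.mem_range.1 hi)))]]
  by_cases ha : e 0 ≤ a
  · rw [Finset.sum_eq_single (e 0)]
    · simp [ha]
    · intro i _ hi
      exact if_neg fun hc => hi hc.1.symm
    · intro hn
      exact absurd (Finset.mem_range.2 (Nat.lt_succ_iff.2 ha)) hn
  · rw [if_neg fun h => ha h.1]
    refine Finset.sum_eq_zero fun i hi => if_neg fun hc => ha ?_
    rw [hc.1]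
    exact Nat.lt_succ_iff.1 (Finset.mem_range.1 hi)

lemma isWeightedHomogeneous_rename {p : MvPolynomial (Fin 2) ℂ} {n : ℕ} (m : ℕ)
    (hp : p.IsHomogeneous n) :
    (rename Sum.inr p : MvPolynomial Var ℂ).IsWeightedHomogeneous (wt m) ((0 : ℤ), (n : ℤ)) := by
  intro e he
  obtain ⟨d, rfl, hd⟩ := coeff_rename_ne_zero _ _ _ he
  have hinl : ∀ k : Fin 2, Finsupp.mapDomain (Sum.inr : Fin 2 → Var) d (Sum.inl k) = 0 :=
    fun k => Finsupp.mapDomain_of_notMem_range _ _ (by simp)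
  rw [weight_wt, hinl, hinl, Finsupp.mapDomain_apply Sum.inr_injective,
    Finsupp.mapDomain_apply Sum.inr_injective]
  have h := hp hd
  rw [Finsupp.weight_apply, Finsupp.sum_fintype _ _ (by simp), Fin.sum_univ_two] at h
  simp only [Pi.one_apply, smul_eq_mul, mul_one] at h
  rw [← h]
  simp

lemma isWeightedHomogeneous_formSum {a m : ℕ} {g : ℕ → MvPolynomial (Fin 2) ℂ}
    (hg : ∀ i ≤ a, (g i).IsHomogeneous (m * (a - i))) :
    (formSum a g).IsWeightedHomogeneous (wt m) ((a : ℤ), (0 : ℤ)) := by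
  refine IsWeightedHomogeneous.sum _ _ _ fun i hi => ?_
  have hia := Nat.lt_succ_iff.1 (Finset.mem_range.1 hi)
  have h := (((isWeightedHomogeneous_X ℂ (wt m) (Sum.inl 0)).pow i).mul
    ((isWeightedHomogeneous_X ℂ (wt m) (Sum.inl 1)).pow (a - i))).mul
    (isWeightedHomogeneous_rename m (hg i hia))
  convert h using 1
  ext
  · simp [wt]
    omega
  · simp [wt]
    ring

/-- The coefficients `g_i` of the homogenization `∑ x₀ⁱ x₁^(a-i) g_i(y₀, y₁)` of a polynomial of
bidegree `(a, am)`. -/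
def homogCoeff (a m : ℕ) (F : MvPolynomial (Fin 2) ℂ) (i : ℕ) : MvPolynomial (Fin 2) ℂ :=
  ∑ k ∈ Finset.range (m * (a - i) + 1),
    monomial (expo 1 k (m * (a - i) - k)) (coeff (expo 1 i k) F)

lemma isHomogeneous_homogCoeff (a m : ℕ) (F : MvPolynomial (Fin 2) ℂ) (i : ℕ) :
    (homogCoeff a m F i).IsHomogeneous (m * (a - i)) := by
  refine IsHomogeneous.sum _ _ _ fun k hk => isHomogeneous_monomial _ ?_
  have := Nat.lt_succ_iff.1 (Finset.mem_range.1 hk)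
  simp only [expo, map_add, Finsupp.degree_single]
  omega

lemma coeff_homogCoeff {a m : ℕ} (F : MvPolynomial (Fin 2) ℂ) {i k : ℕ}
    (hk : k ≤ m * (a - i)) :
    coeff (expo 1 k (m * (a - i) - k)) (homogCoeff a m F i) = coeff (expo 1 i k) F := by
  rw [homogCoeff, coeff_sum, Finset.sum_eq_single k]
  · rw [coeff_monomial, if_pos rfl]
  · intro l _ hl
    rw [coeff_monomial, if_neg]
    intro h
    have := DFunLike.congr_fun h (1 - 1)
    rw [expo_apply_sub, expo_apply_sub] at this
    exact hl this
  · intro hn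
    exact absurd (Finset.mem_range.2 (Nat.lt_succ_iff.2 hk)) hn

lemma hasBidegree_mul_iff {a m r : ℕ} (hm : 1 ≤ m) (hr : r < a) (F : MvPolynomial (Fin 2) ℂ) :
    HasBidegree F a (a * m - r) ↔ F ≠ 0 ∧
      ∀ e, coeff e F ≠ 0 → e 0 ≤ a ∧ e 1 + (r - e 0 * r / a) ≤ m * (a - e 0) := by
  have hb : 0 < a * m - r := Nat.sub_pos_of_lt (by nlinarith)
  rw [hasBidegree_iff (by omega) hb]
  simp only [bidegree_bound_iff hm hr]

lemma dehom_formSum_homogCoeff {a m : ℕ} {F : MvPolynomial (Fin 2) ℂ}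
    (hF : ∀ e, coeff e F ≠ 0 → e 0 ≤ a ∧ e 1 ≤ m * (a - e 0)) :
    dehom 1 1 (formSum a (homogCoeff a m F)) = F := by
  ext e
  rw [coeff_dehom_formSum fun i _ => isHomogeneous_homogCoeff a m F i]
  split_ifs with h
  · rw [coeff_homogCoeff F h.2, ← show e = expo 1 (e 0) (e 1) from eq_expo 1 e]
  · by_contra hn
    exact h (hF e (Ne.symm hn))

lemma exists_of_coeff_dehom_ne_zero {G : MvPolynomial Var ℂ} {e : Fin 2 →₀ ℕ}
    (he : coeff e (dehom 1 1 G) ≠ 0) :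
    ∃ E, coeff E G ≠ 0 ∧ e 0 = E (Sum.inl 0) ∧ e 1 = E (Sum.inr 0) := by
  have hmon : ∀ E c, dehom 1 1 (monomial E c)
      = monomial (expo 1 (E (Sum.inl 0)) (E (Sum.inr 0))) c := fun E c => by
    rw [dehom, aeval_monomial, Finsupp.prod_fintype _ _ (by simp), Fintype.prod_sum_type,
      Fin.prod_univ_two, Fin.prod_univ_two, expo]
    simp [algebraMap_eq, X_pow_eq_monomial, C_mul_monomial, monomial_mul]
  rw [G.as_sum, map_sum, coeff_sum] at he
  obtain ⟨E, hE, hEe⟩ := Finset.exists_ne_zero_of_sum_ne_zero he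
  rw [hmon, coeff_monomial] at hEe
  refine ⟨E, mem_support_iff.1 hE, ?_⟩
  have h : expo 1 (E (Sum.inl 0)) (E (Sum.inr 0)) = e := by
    by_contra hn
    rw [if_neg hn] at hEe
    exact hEe rfl
  rw [← h]
  exact ⟨expo_apply_sub 1 _ _, expo_apply_same 1 _ _⟩

lemma bound_of_coeff_dehom_ne_zero {a m : ℕ} {G : MvPolynomial Var ℂ}
    (hG : G.IsWeightedHomogeneous (wt m) ((a : ℤ), (0 : ℤ))) (e : Fin 2 →₀ ℕ)
    (he : coeff e (dehom 1 1 G) ≠ 0) : e 0 ≤ a ∧ e 1 ≤ m * (a - e 0) := by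
  obtain ⟨E, hE, h0, h1⟩ := exists_of_coeff_dehom_ne_zero he
  have h := hG hE
  rw [weight_wt, Prod.mk.injEq] at h
  have h2 : e 0 + E (Sum.inl 1) = a := by omega
  have h3 : e 1 + E (Sum.inr 1) = m * E (Sum.inl 1) := by
    zify
    rw [h1]
    linarith [h.2]
  refine ⟨by omega, ?_⟩
  rw [show a - e 0 = E (Sum.inl 1) by omega]
  omega

lemma hasBidegree_zero_iff {a m : ℕ} (ha : 1 ≤ a) (hm : 1 ≤ m) (F : MvPolynomial (Fin 2) ℂ) :
    HasBidegree F a (a * m) ↔ F ≠ 0 ∧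
      ∀ e, coeff e F ≠ 0 → e 0 ≤ a ∧ e 1 ≤ m * (a - e 0) := by
  simpa using hasBidegree_mul_iff hm (r := 0) (by omega) F

/-- A polynomial `F` of bidegree `(a, am)` has `D` as its divisor exactly if `D` is the divisor of
a form of degree `(a, 0)` that dehomogenizes to `F`. -/
lemma isDivisorOf_iff {a m : ℕ} (ha : 1 ≤ a) (hm : 1 ≤ m) {F : MvPolynomial (Fin 2) ℂ}
    {D : Divisor m} : IsDivisorOf a F D ↔ ∃ G : Form m,
      G.1.IsWeightedHomogeneous (wt m) ((a : ℤ), (0 : ℤ)) ∧ dehom 1 1 G.1 = F ∧ G.div = D := by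
  constructor
  · rintro ⟨hF, hD, hlin, hres⟩
    obtain ⟨G, hG, rfl⟩ := exists_div_eq_of_linEquiv hD hlin
    obtain ⟨c, hc, rfl⟩ := associated_iff_exists_smul.1 ((restrictsTo_div_iff G hF.1).1 hres)
    have hcG : C c * G.1 ≠ 0 := mul_ne_zero (C_ne_zero.2 hc) G.2.1
    let G' : Form m := ⟨C c * G.1, hcG, _, hG.C_mul c⟩
    refine ⟨G', hG.C_mul c, ?_, ?_⟩
    · change dehom 1 1 (C c * G.1) = _
      rw [C_mul', map_smul]
    · refine ((Form.associated_iff (P := G) (G := G')).1 ?_).symm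
      exact associated_iff_exists_smul.2 ⟨c, hc, C_mul'⟩
  · rintro ⟨G, hG, rfl, rfl⟩
    exact ⟨(hasBidegree_zero_iff ha hm _).2 ⟨G.dehom_ne_zero 1 1, bound_of_coeff_dehom_ne_zero hG⟩,
      G.div_nonneg, linEquiv_div hG, (restrictsTo_div_iff G (G.dehom_ne_zero 1 1)).2
        (Associated.refl _)⟩

lemma X_pow_dvd_iff_forall_coeff {σ : Type*} {k : ℕ} {s : σ} {p : MvPolynomial σ ℂ} :
    X s ^ k ∣ p ↔ ∀ d, coeff d p ≠ 0 → k ≤ d s := by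
  rw [X_pow_eq_monomial, monomial_one_dvd_iff_modMonomial_eq_zero]
  constructor
  · intro h d hd
    by_contra hk
    have h1 := congrArg (coeff d) h
    rw [coeff_modMonomial_of_not_le _ (fun hle => hk (by simpa using hle s)), coeff_zero] at h1
    exact hd h1
  · intro h
    ext d
    by_cases hk : Finsupp.single s k ≤ d
    · rw [coeff_modMonomial_of_le _ hk, coeff_zero]
    · rw [coeff_modMonomial_of_not_le _ hk, coeff_zero]
      by_contra hd
      exact hk (Finsupp.single_le_iff.2 (h d hd))

lemma forall_coeff_dehom_formSum_iff {a m : ℕ} {g : ℕ → MvPolynomial (Fin 2) ℂ}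
    (hg : ∀ i ≤ a, (g i).IsHomogeneous (m * (a - i))) (k : ℕ → ℕ) :
    (∀ e, coeff e (dehom 1 1 (formSum a g)) ≠ 0 →
        e 0 ≤ a ∧ e 1 + k (e 0) ≤ m * (a - e 0)) ↔
      ∀ i ≤ a, (X 1 : MvPolynomial (Fin 2) ℂ) ^ k i ∣ g i := by
  simp only [X_pow_dvd_iff_forall_coeff]
  constructor
  · intro h i hi d hd
    obtain ⟨hle, hexp⟩ := eq_expo_of_isHomogeneous (hg i hi) hd 1
    have h1 := h (expo 1 i (d (1 - 1)))
    rw [coeff_dehom_formSum hg] at h1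
    rw [show expo 1 i (d (1 - 1)) 0 = i from expo_apply_sub 1 _ _, expo_apply_same,
      if_pos ⟨hi, hle⟩, ← hexp] at h1
    have h2 := (h1 hd).2
    have h3 := DFunLike.congr_fun hexp 1
    rw [expo_apply_same] at h3
    omega
  · intro h e he
    rw [coeff_dehom_formSum hg] at he
    split_ifs at he with hc
    · refine ⟨hc.1, ?_⟩
      have := h (e 0) hc.1 _ he
      rw [expo_apply_same] at this
      omega
    · exact absurd rfl he

/-! ### Intersection numbers with the line `y = 0` in the affine plane -/

/-- The restriction of a polynomial in two variables to the line `X 1 = 0`. -/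
def restrictLine : MvPolynomial (Fin 2) ℂ →ₐ[ℂ] Polynomial ℂ := aeval ![Polynomial.X, 0]

lemma coeff_restrictLine (f : MvPolynomial (Fin 2) ℂ) (i : ℕ) :
    (restrictLine f).coeff i = coeff (expo 1 i 0) f := by
  induction f using MvPolynomial.induction_on' with
  | monomial d c =>
    rw [restrictLine, aeval_monomial, Finsupp.prod_fintype _ _ (by simp), Fin.prod_univ_two,
      coeff_monomial]
    have h : d = expo 1 i 0 ↔ d 0 = i ∧ d 1 = 0 := by
      constructor
      · rintro rfl
        exact ⟨expo_apply_sub 1 _ _, expo_apply_same 1 _ _⟩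
      · rintro ⟨h0, h1⟩
        rw [← h0, ← h1]
        exact eq_expo 1 d
    simp only [h]
    by_cases h1 : d 1 = 0
    · simp [h1, Polynomial.coeff_X_pow, eq_comm]
    · simp [h1]
  | add p q hp hq => rw [map_add, Polynomial.coeff_add, hp, hq, coeff_add]

lemma exists_eq_aeval_restrictLine_add (f : MvPolynomial (Fin 2) ℂ) :
    ∃ h, f = Polynomial.aeval (X 0) (restrictLine f) + X 1 * h := by
  have key : (Ideal.Quotient.mkₐ ℂ (Ideal.span {(X 1 : MvPolynomial (Fin 2) ℂ)})).comp
      ((Polynomial.aeval (X 0)).comp restrictLine) = Ideal.Quotient.mkₐ ℂ _ := by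
    ext k
    fin_cases k
    · simp [restrictLine]
    · simp [restrictLine]
  have h := (Ideal.Quotient.eq (I := Ideal.span {(X 1 : MvPolynomial (Fin 2) ℂ)})).1
    (DFunLike.congr_fun key f).symm
  obtain ⟨q, hq⟩ := Ideal.mem_span_singleton.1 h
  exact ⟨q, by rw [← hq]; simp⟩

lemma mem_vanishingIdeal_zero_iff (f : MvPolynomial (Fin 2) ℂ) :
    f ∈ vanishingIdeal ℂ ({0} : Set (Fin 2 → ℂ)) ↔ coeff 0 f = 0 := by
  rw [mem_vanishingIdeal_singleton_iff, aeval_eq_eval, ← constantCoeff_eq, eval_zero]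

/-- At the origin, the local intersection number of the line `X 1 = 0` with the curve `f = 0` is the
order of vanishing at the origin of the restriction of `f` to the line. -/
lemma planeInter_span_X_one {f : MvPolynomial (Fin 2) ℂ} {k : ℕ}
    (hlt : ∀ i < k, coeff (expo 1 i 0) f = 0) (hk : coeff (expo 1 k 0) f ≠ 0) :
    planeInter (Ideal.span {X 1}) (Ideal.span {f}) 0 = k := by
  set p := vanishingIdeal ℂ ({0} : Set (Fin 2 → ℂ)) with hp
  set B := AdjoinRoot (Polynomial.X ^ k : Polynomial ℂ) with hB
  obtain ⟨u, hu⟩ : (Polynomial.X ^ k : Polynomial ℂ) ∣ restrictLine f := by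
    refine Polynomial.X_pow_dvd_iff.2 fun i hi => ?_
    rw [coeff_restrictLine, hlt i hi]
  have hu0 : u.coeff 0 ≠ 0 := by
    rw [← coeff_restrictLine, hu] at hk
    simpa [Polynomial.coeff_X_pow_mul'] using hk
  let φ : MvPolynomial (Fin 2) ℂ →ₐ[ℂ] B := (AdjoinRoot.mkₐ _).comp restrictLine
  have hφ : ∀ g, φ g = 0 ↔ (Polynomial.X ^ k : Polynomial ℂ) ∣ restrictLine g :=
    fun g => AdjoinRoot.mk_eq_zero
  have hunit : ∀ s : p.primeCompl, IsUnit (φ s) := by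
    rintro ⟨s, hs⟩
    have hs0 : coeff 0 s ≠ 0 := fun h => hs ((mem_vanishingIdeal_zero_iff s).2 h)
    have hcop : IsCoprime (Polynomial.X ^ k : Polynomial ℂ) (restrictLine s) := by
      refine IsCoprime.pow_left ((Polynomial.irreducible_X.coprime_iff_not_dvd).2 ?_)
      rw [Polynomial.X_dvd_iff, coeff_restrictLine]
      simpa [expo] using hs0
    obtain ⟨A, C, hAC⟩ := hcop
    have h1 := congrArg (AdjoinRoot.mk (Polynomial.X ^ k : Polynomial ℂ)) hAC
    rw [map_add, map_mul, map_mul, AdjoinRoot.mk_self, mul_zero, zero_add, map_one] at h1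
    exact IsUnit.of_mul_eq_one_right _ h1
  let ψ : Localization.AtPrime p →ₐ[ℂ] B := IsLocalization.liftAlgHom (M := p.primeCompl) hunit
  have hψ : ∀ g, ψ (algebraMap _ _ g) = φ g := fun g => by
    exact IsLocalization.lift_eq _ g
  have hsurj : Function.Surjective ψ := by
    intro b
    obtain ⟨q, rfl⟩ := AdjoinRoot.mk_surjective b
    refine ⟨algebraMap (MvPolynomial (Fin 2) ℂ) _ (Polynomial.aeval (X 0) q), ?_⟩
    rw [hψ]
    change AdjoinRoot.mk _ (restrictLine _) = _
    congr 1
    rw [← Polynomial.aeval_algHom_apply]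
    simp [restrictLine]
  have hker : RingHom.ker ψ = (Ideal.span {X 1} ⊔ Ideal.span {f}).map
      (algebraMap (MvPolynomial (Fin 2) ℂ) (Localization.AtPrime p)) := by
    set J := (Ideal.span {X 1} ⊔ Ideal.span {f}).map
      (algebraMap (MvPolynomial (Fin 2) ℂ) (Localization.AtPrime p)) with hJ
    have hXJ : algebraMap _ (Localization.AtPrime p) (X 1 : MvPolynomial (Fin 2) ℂ) ∈ J :=
      Ideal.mem_map_of_mem _ (Ideal.mem_sup_left (Ideal.mem_span_singleton_self _))
    have hfJ : algebraMap _ (Localization.AtPrime p) f ∈ J :=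
      Ideal.mem_map_of_mem _ (Ideal.mem_sup_right (Ideal.mem_span_singleton_self _))
    apply le_antisymm
    · -- Modulo `X 1`, the polynomial `f` is `X 0 ^ k` times a unit of the local ring.
      have hX0 : algebraMap _ (Localization.AtPrime p) (X 0 ^ k : MvPolynomial (Fin 2) ℂ) ∈ J := by
        obtain ⟨h, hh⟩ := exists_eq_aeval_restrictLine_add f
        have hU : IsUnit (algebraMap _ (Localization.AtPrime p)
            (Polynomial.aeval (X 0 : MvPolynomial (Fin 2) ℂ) u)) := by
          refine IsLocalization.map_units (M := p.primeCompl) _ ⟨_, fun hmem => hu0 ?_⟩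
          have hmem' : Polynomial.aeval (X 0 : MvPolynomial (Fin 2) ℂ) u ∈ p := hmem
          rw [hp, mem_vanishingIdeal_singleton_iff, ← Polynomial.aeval_algHom_apply] at hmem'
          simpa [Polynomial.coeff_zero_eq_aeval_zero] using hmem'
        have h1 : (X 0 ^ k : MvPolynomial (Fin 2) ℂ) * Polynomial.aeval (X 0) u = f - X 1 * h := by
          conv_rhs => rw [hh, hu]
          simp
        rw [← Ideal.mul_unit_mem_iff_mem _ hU, ← map_mul, h1, map_sub, map_mul]
        exact Ideal.sub_mem _ hfJ (Ideal.mul_mem_right _ _ hXJ)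
      intro z hz
      obtain ⟨⟨g, s⟩, hgs⟩ := IsLocalization.surj p.primeCompl z
      have hg : φ g = 0 := by
        rw [← hψ, ← hgs, map_mul, (RingHom.mem_ker).1 hz, zero_mul]
      obtain ⟨w, hw⟩ := (hφ g).1 hg
      obtain ⟨h, hh⟩ := exists_eq_aeval_restrictLine_add g
      rw [← Ideal.mul_unit_mem_iff_mem _ (IsLocalization.map_units _ s), hgs, hh, hw]
      simp only [map_mul, map_add, map_pow, Polynomial.aeval_X]
      rw [map_pow] at hX0
      exact Ideal.add_mem _ (Ideal.mul_mem_right _ _ hX0) (Ideal.mul_mem_right _ _ hXJ)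
    · rw [hJ, Ideal.map_le_iff_le_comap, sup_le_iff, Ideal.span_singleton_le_iff_mem,
        Ideal.span_singleton_le_iff_mem, Ideal.mem_comap, Ideal.mem_comap, RingHom.mem_ker,
        RingHom.mem_ker, hψ, hψ, hφ, hφ]
      exact ⟨by simp [restrictLine], ⟨u, hu⟩⟩
  have hrank : Module.rank ℂ B = k := by
    rw [rank_eq_card_basis (AdjoinRoot.powerBasis' (Polynomial.monic_X_pow k)).basis,
      Fintype.card_fin, AdjoinRoot.powerBasis'_dim, Polynomial.natDegree_X_pow]
  rw [planeInter, ← hker,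
    (Ideal.quotientKerAlgEquivOfSurjective hsurj).toLinearEquiv.rank_eq, hrank]
  simp

/-! ### Multiplicities and tangent cones at the origin of the affine plane -/

lemma vanishingIdeal_zero :
    vanishingIdeal ℂ ({0} : Set (Fin 2 → ℂ)) = idealOfVars (Fin 2) ℂ := by
  ext f
  have h := mem_pow_idealOfVars_iff' (R := ℂ) (σ := Fin 2) 1 f
  rw [pow_one] at h
  rw [mem_vanishingIdeal_zero_iff, h]
  constructor
  · intro h0 x hx
    rw [(Finsupp.degree_eq_zero_iff x).1 (Nat.lt_one_iff.1 hx), h0]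
  · exact fun h => h 0 (by simp)

lemma natCast_le_planeMult_iff (f : MvPolynomial (Fin 2) ℂ) (n : ℕ) :
    (n : ℕ∞) ≤ planeMult (Ideal.span {f}) 0 ↔ ∀ e, Finsupp.degree e < n → coeff e f = 0 := by
  have hmem : ∀ k, Ideal.span {f} ≤ vanishingIdeal ℂ ({0} : Set (Fin 2 → ℂ)) ^ k ↔
      ∀ e, Finsupp.degree e < k → coeff e f = 0 := fun k => by
    rw [Ideal.span_singleton_le_iff_mem, vanishingIdeal_zero, mem_pow_idealOfVars_iff']
  simp only [planeMult, hmem]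
  constructor
  · intro h
    by_contra hn
    have hlt : ∀ k, (∀ e, Finsupp.degree e < k → coeff e f = 0) → k < n := fun k hk => by
      by_contra hkn
      exact hn fun e he => hk e (he.trans_le (not_lt.1 hkn))
    have h1 : (⨆ (k : ℕ) (_ : ∀ e, Finsupp.degree e < k → coeff e f = 0), (k : ℕ∞))
        ≤ ((n - 1 : ℕ) : ℕ∞) :=
      iSup₂_le fun k hk => Nat.cast_le.2 (Nat.le_sub_one_of_lt (hlt k hk))
    have h2 := Nat.cast_le.1 (h.trans h1)
    have h3 := hlt 0 (by simp)
    omega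
  · exact fun h => le_iSup₂_of_le n h le_rfl

/-- The tangent cone of the curve `f = 0` at the origin is the zero set of the initial form of
`f`. -/
lemma mem_planeTangentCone_iff {f : MvPolynomial (Fin 2) ℂ} {n : ℕ}
    (hn : planeMult (Ideal.span {f}) 0 = n) (v : Fin 2 → ℂ) :
    v ∈ planeTangentCone (Ideal.span {f}) 0 ↔ eval v (homogeneousComponent n f) = 0 := by
  have hshift : ∀ h : MvPolynomial (Fin 2) ℂ,
      aeval (fun k => X k + C ((0 : Fin 2 → ℂ) k)) h = h := fun h => by
    simp
  have hf : f ∈ idealOfVars (Fin 2) ℂ ^ n :=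
    (mem_pow_idealOfVars_iff' _ _).2 ((natCast_le_planeMult_iff f n).1 hn.ge)
  simp only [planeTangentCone, hn, ENat.toNat_natCast, hshift]
  constructor
  · exact fun h => h f (Ideal.mem_span_singleton_self f)
  · intro h g hg
    obtain ⟨q, rfl⟩ := Ideal.mem_span_singleton.1 hg
    have h1 : homogeneousComponent n (f * q) = C (coeff 0 q) * homogeneousComponent n f := by
      have h2 : q - C (coeff 0 q) ∈ idealOfVars (Fin 2) ℂ := by
        rw [← vanishingIdeal_zero, mem_vanishingIdeal_zero_iff]
        simp
      have h3 : f * (q - C (coeff 0 q)) ∈ idealOfVars (Fin 2) ℂ ^ (n + 1) := by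
        rw [pow_succ]
        exact Ideal.mul_mem_mul hf h2
      have h4 : homogeneousComponent n (f * (q - C (coeff 0 q))) = 0 := by
        ext e
        rw [coeff_homogeneousComponent, coeff_zero]
        split_ifs with he
        · exact (mem_pow_idealOfVars_iff' _ _).1 h3 e (by omega)
        · rfl
      rw [mul_sub, map_sub, sub_eq_zero] at h4
      rw [h4, mul_comm, homogeneousComponent_C_mul]
    rw [h1, map_mul, h, mul_zero]

lemma planeMult_span_X_one : planeMult (Ideal.span {(X 1 : MvPolynomial (Fin 2) ℂ)}) 0 = 1 := by
  apply le_antisymm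
  · by_contra hn
    replace hn := Order.add_one_le_of_lt (not_le.1 hn)
    have h := (natCast_le_planeMult_iff (X 1) 2).1 (by exact_mod_cast hn) (Finsupp.single 1 1)
      (by simp)
    simp at h
  · refine (natCast_le_planeMult_iff (X 1) 1).2 fun e he => ?_
    rw [(Finsupp.degree_eq_zero_iff e).1 (Nat.lt_one_iff.1 he)]
    simp

lemma planeTangentCone_span_X_one :
    planeTangentCone (Ideal.span {(X 1 : MvPolynomial (Fin 2) ℂ)}) 0 = {v | v 1 = 0} := by
  ext v
  rw [mem_planeTangentCone_iff (n := 1) planeMult_span_X_one]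
  have h : homogeneousComponent 1 (X 1 : MvPolynomial (Fin 2) ℂ) = X 1 := by
    rw [homogeneousComponent_of_mem (isHomogeneous_X ℂ (1 : Fin 2)), if_pos rfl]
  rw [h, eval_X]
  rfl

lemma expo_one_eq_iff {k l k' l' : ℕ} : expo 1 k l = expo 1 k' l' ↔ k = k' ∧ l = l' := by
  constructor
  · intro h
    have h0 := DFunLike.congr_fun h (1 - 1)
    have h1 := DFunLike.congr_fun h 1
    rw [expo_apply_sub, expo_apply_sub] at h0
    rw [expo_apply_same, expo_apply_same] at h1
    exact ⟨h0, h1⟩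
  · rintro ⟨rfl, rfl⟩
    rfl

lemma eval_homogeneousComponent_two (f : MvPolynomial (Fin 2) ℂ) (v : Fin 2 → ℂ) :
    eval v (homogeneousComponent 2 f) = coeff (expo 1 2 0) f * v 0 ^ 2
      + coeff (expo 1 1 1) f * (v 0 * v 1) + coeff (expo 1 0 2) f * v 1 ^ 2 := by
  have h : homogeneousComponent 2 f = monomial (expo 1 2 0) (coeff (expo 1 2 0) f)
      + monomial (expo 1 1 1) (coeff (expo 1 1 1) f)
      + monomial (expo 1 0 2) (coeff (expo 1 0 2) f) := by
    ext e
    have he := eq_expo 1 e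
    generalize e (1 - 1) = k at he
    generalize e 1 = l at he
    subst he
    have hdeg : Finsupp.degree (expo 1 k l) = k + l := by simp [expo]
    rw [coeff_homogeneousComponent, hdeg, coeff_add, coeff_add, coeff_monomial, coeff_monomial,
      coeff_monomial]
    by_cases h1 : k + l = 2
    · obtain ⟨rfl, rfl⟩ | ⟨rfl, rfl⟩ | ⟨rfl, rfl⟩ :
        (k = 0 ∧ l = 2) ∨ (k = 1 ∧ l = 1) ∨ (k = 2 ∧ l = 0) := by omega
      all_goals simp [expo_one_eq_iff]
    · simp only [expo_one_eq_iff]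
      rw [if_neg h1, if_neg (by omega), if_neg (by omega), if_neg (by omega), add_zero, add_zero]
  rw [h]
  simp [eval_monomial, expo, Finsupp.prod_fintype, Fin.prod_univ_two]

/-- A binary quadratic form whose only zero line is `X 1 = 0` is a multiple of `X 1 ^ 2`. So the
origin is a point of multiplicity at least three, or a double point with this line as its only
tangent, exactly if all terms of degree at most two other than `X 1 ^ 2` vanish. -/
lemma mult_and_tangent_iff (f : MvPolynomial (Fin 2) ℂ) :
    (3 ≤ planeMult (Ideal.span {f}) 0 ∨ (planeMult (Ideal.span {f}) 0 = 2 ∧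
      planeTangentCone (Ideal.span {f}) 0 = planeTangentCone (Ideal.span {X 1}) 0)) ↔
    coeff (expo 1 0 0) f = 0 ∧ coeff (expo 1 1 0) f = 0 ∧ coeff (expo 1 0 1) f = 0 ∧
      coeff (expo 1 2 0) f = 0 ∧ coeff (expo 1 1 1) f = 0 := by
  have hdeg : ∀ k l : ℕ, Finsupp.degree (expo 1 k l) = k + l := fun k l => by simp [expo]
  have hall : ∀ n : ℕ, (n : ℕ∞) ≤ planeMult (Ideal.span {f}) 0 ↔
      ∀ k l : ℕ, k + l < n → coeff (expo 1 k l) f = 0 := by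
    intro n
    rw [natCast_le_planeMult_iff]
    constructor
    · exact fun h k l hkl => h _ (by rwa [hdeg])
    · intro h e he
      rw [eq_expo 1 e] at he ⊢
      exact h _ _ (by rwa [hdeg] at he)
  have h3 := hall 3
  have h2 := hall 2
  rw [planeTangentCone_span_X_one]
  constructor
  · rintro (h | ⟨h, ht⟩)
    · have := h3.1 h
      exact ⟨this 0 0 (by norm_num), this 1 0 (by norm_num), this 0 1 (by norm_num),
        this 2 0 (by norm_num), this 1 1 (by norm_num)⟩
    · have h4 := h2.1 h.ge
      have hcone : ∀ v : Fin 2 → ℂ, coeff (expo 1 2 0) f * v 0 ^ 2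
          + coeff (expo 1 1 1) f * (v 0 * v 1) + coeff (expo 1 0 2) f * v 1 ^ 2 = 0 ↔
            v 1 = 0 := fun v => by
        rw [← eval_homogeneousComponent_two, ← mem_planeTangentCone_iff h, ht]
        rfl
      have h20 : coeff (expo 1 2 0) f = 0 := by
        simpa using (hcone ![1, 0]).2 rfl
      refine ⟨h4 0 0 (by norm_num), h4 1 0 (by norm_num), h4 0 1 (by norm_num), h20, ?_⟩
      have := (hcone ![coeff (expo 1 0 2) f, -coeff (expo 1 1 1) f]).1 (by
        simp [h20]
        ring)
      simpa using this
  · rintro ⟨h00, h10, h01, h20, h11⟩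
    by_cases h02 : coeff (expo 1 0 2) f = 0
    · refine Or.inl (h3.2 fun k l hkl => ?_)
      obtain ⟨rfl, rfl⟩ | ⟨rfl, rfl⟩ | ⟨rfl, rfl⟩ | ⟨rfl, rfl⟩ | ⟨rfl, rfl⟩ | ⟨rfl, rfl⟩ :
        (k = 0 ∧ l = 0) ∨ (k = 1 ∧ l = 0) ∨ (k = 0 ∧ l = 1) ∨ (k = 2 ∧ l = 0) ∨
          (k = 1 ∧ l = 1) ∨ (k = 0 ∧ l = 2) := by omega
      all_goals assumption
    · have hm : planeMult (Ideal.span {f}) 0 = (2 : ℕ) := by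
        apply le_antisymm
        · by_contra hn
          replace hn := Order.add_one_le_of_lt (not_le.1 hn)
          exact h02 (h3.1 (by exact_mod_cast hn) 0 2 (by norm_num))
        · refine h2.2 fun k l hkl => ?_
          obtain ⟨rfl, rfl⟩ | ⟨rfl, rfl⟩ | ⟨rfl, rfl⟩ :
            (k = 0 ∧ l = 0) ∨ (k = 1 ∧ l = 0) ∨ (k = 0 ∧ l = 1) := by omega
          all_goals assumption
      refine Or.inr ⟨hm, ?_⟩
      ext v
      rw [mem_planeTangentCone_iff hm, eval_homogeneousComponent_two, h20, h11]
      simp [h02]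

/-! ### Local invariants at the point `p` -/

lemma chart_eq_pointP_iff {m : ℕ} {i j : Fin 2} {q : Fin 2 → ℂ} :
    chart m i j q = pointP m ↔ i = 1 ∧ j = 0 ∧ q = 0 := by
  constructor
  · intro h
    obtain ⟨l, μ, hl, hμ, h1, h2, h3, h4⟩ := Quotient.exact h
    have hi : i = 0 ∨ i = 1 := by fin_cases i <;> simp
    have hj : j = 0 ∨ j = 1 := by fin_cases j <;> simp
    rcases hi with rfl | rfl
    · simp at h1
    rcases hj with rfl | rfl
    · refine ⟨rfl, rfl, ?_⟩
      ext k
      fin_cases k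
      · simpa using h1
      · simpa using h4
    · simp at h4
  · rintro ⟨rfl, rfl, rfl⟩
    refine congrArg (mk m) (Subtype.ext ?_)
    funext s
    rcases s with s | s <;> fin_cases s <;> rfl

lemma iInf_chart_eq_pointP {m : ℕ} (φ : Fin 2 → Fin 2 → (Fin 2 → ℂ) → ℕ∞) :
    (⨅ (i : Fin 2) (j : Fin 2) (q : Fin 2 → ℂ) (_ : chart m i j q = pointP m), φ i j q)
      = φ 1 0 0 := by
  apply le_antisymm
  · exact iInf_le_of_le 1 (iInf_le_of_le 0 (iInf_le_of_le 0
      (iInf_le_of_le (chart_eq_pointP_iff.2 ⟨rfl, rfl, rfl⟩) le_rfl)))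
  · refine le_iInf fun i => le_iInf fun j => le_iInf fun q => le_iInf fun h => ?_
    obtain ⟨rfl, rfl, rfl⟩ := chart_eq_pointP_iff.1 h
    exact le_rfl

lemma divisorIdeal_fiber (m : ℕ) : divisorIdeal (fiber m) 1 0 = Ideal.span {X 1} := by
  rw [fiber, divisorIdeal_div]
  congr 2
  change dehom 1 0 (X (Sum.inr 1)) = X 1
  simp [dehom]

lemma multAt_div_pointP {m : ℕ} (G : Form m) :
    multAt G.div (pointP m) = planeMult (Ideal.span {dehom 1 0 G.1}) 0 := by
  rw [multAt, iInf_chart_eq_pointP fun i j q => planeMult (divisorIdeal G.div i j) q,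
    divisorIdeal_div]

lemma interAt_fiber_div_pointP {m : ℕ} (G : Form m) :
    interAt (fiber m) G.div (pointP m)
      = planeInter (Ideal.span {X 1}) (Ideal.span {dehom 1 0 G.1}) 0 := by
  rw [interAt, iInf_chart_eq_pointP fun i j q =>
    planeInter (divisorIdeal (fiber m) i j) (divisorIdeal G.div i j) q, divisorIdeal_div,
    divisorIdeal_fiber]

lemma sameTangents_div_fiber_pointP {m : ℕ} (G : Form m) :
    SameTangents G.div (fiber m) (pointP m) ↔
      planeTangentCone (Ideal.span {dehom 1 0 G.1}) 0 = planeTangentCone (Ideal.span {X 1}) 0 := by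
  rw [← divisorIdeal_fiber m, ← divisorIdeal_div]
  constructor
  · exact fun h => h 1 0 0 (chart_eq_pointP_iff.2 ⟨rfl, rfl, rfl⟩)
  · intro h i j q hq
    obtain ⟨rfl, rfl, rfl⟩ := chart_eq_pointP_iff.1 hq
    exact h

lemma isComponent_fiber_iff {m : ℕ} (G : Form m) :
    IsComponent (Form.var m (Sum.inr 1)) G.div ↔
      ∀ i, coeff (expo 1 i 0) (dehom 1 0 G.1) = 0 := by
  obtain ⟨d, hd⟩ := G.2.2
  have hirr : Irreducible (X (Sum.inr 1) : MvPolynomial Var ℂ) := X_prime.irreducible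
  have hmeet : MeetsChart (X (Sum.inr 1)) 1 0 :=
    ⟨X_not_dvd_X_of_ne (by simp), X_not_dvd_X_of_ne (by simp)⟩
  rw [isComponent_div_iff _ _ hirr]
  change X (Sum.inr 1) ∣ G.1 ↔ _
  have h := hmeet.pow_dehom_dvd_iff hirr (isWeightedHomogeneous_X ℂ (wt m) (Sum.inr 1)) hd 1
  rw [show dehom 1 0 (X (Sum.inr 1)) = X 1 by simp [dehom], pow_one (X (Sum.inr 1))] at h
  rw [← h, X_pow_dvd_iff_forall_coeff]
  constructor
  · intro h1 i
    by_contra hn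
    have := h1 _ hn
    rw [expo_apply_same] at this
    omega
  · intro h1 e he
    by_contra hn
    refine he ?_
    rw [eq_expo 1 e, show e 1 = 0 by omega]
    exact h1 _

/-! ### Divisors of polynomials on the affine plane -/

/-- The form `∑ x₀ⁱ x₁^(a-i) g_i(y₀, y₁)` of degree `(a, 0)` that homogenizes a polynomial of
bidegree `(a, am)`. -/
lemma exists_homogenization {a m : ℕ} (ha : 1 ≤ a) (hm : 1 ≤ m) {F : MvPolynomial (Fin 2) ℂ}
    (hF : HasBidegree F a (a * m)) : ∃ G : Form m, G.1 = formSum a (homogCoeff a m F) ∧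
      G.1.IsWeightedHomogeneous (wt m) ((a : ℤ), (0 : ℤ)) ∧ dehom 1 1 G.1 = F := by
  obtain ⟨hF0, hFe⟩ := (hasBidegree_zero_iff ha hm F).1 hF
  have h1 := dehom_formSum_homogCoeff hFe
  have h2 := isWeightedHomogeneous_formSum fun i (_ : i ≤ a) => isHomogeneous_homogCoeff a m F i
  refine ⟨⟨formSum a (homogCoeff a m F), fun h0 => hF0 ?_, _, h2⟩, rfl, h2, h1⟩
  rw [← h1, h0, map_zero]

lemma existsUnique_isDivisorOf {a m : ℕ} (ha : 1 ≤ a) (hm : 1 ≤ m) {F : MvPolynomial (Fin 2) ℂ}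
    (hF : HasBidegree F a (a * m)) : ∃! D : Divisor m, IsDivisorOf a F D := by
  obtain ⟨G, -, hG, hGF⟩ := exists_homogenization ha hm hF
  refine ⟨G.div, (isDivisorOf_iff ha hm).2 ⟨G, hG, hGF, rfl⟩, fun D hD => ?_⟩
  obtain ⟨G', hG', hGF', rfl⟩ := (isDivisorOf_iff ha hm).1 hD
  refine (Form.associated_iff (P := G') (G := G)).1 ?_
  rw [eq_of_dehom_eq hG' hG (hGF'.trans hGF.symm)]

lemma isDivisorOf_dehom_div_iff {a m : ℕ} (ha : 1 ≤ a) (hm : 1 ≤ m) {G : Form m}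
    (hG : G.1.IsWeightedHomogeneous (wt m) ((a : ℤ), (0 : ℤ))) (F : MvPolynomial (Fin 2) ℂ) :
    IsDivisorOf a F G.div ↔ ∃ c : ℂ, c ≠ 0 ∧ F = c • dehom 1 1 G.1 := by
  rw [isDivisorOf_iff ha hm]
  constructor
  · rintro ⟨G', hG', rfl, h⟩
    obtain ⟨c, hc, hcG⟩ := associated_iff_exists_smul.1 (Form.associated_iff.2 h.symm)
    exact ⟨c, hc, by rw [hcG, map_smul]⟩
  · rintro ⟨c, hc, rfl⟩
    let G' : Form m := ⟨C c * G.1, mul_ne_zero (C_ne_zero.2 hc) G.2.1, _, hG.C_mul c⟩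
    refine ⟨G', hG.C_mul c, ?_, ?_⟩
    · change dehom 1 1 (C c * G.1) = _
      rw [C_mul', map_smul]
    · exact ((Form.associated_iff (P := G) (G := G')).1
        (associated_iff_exists_smul.2 ⟨c, hc, C_mul'⟩)).symm

lemma not_dvd_X_of_degree {m : ℕ} {P : MvPolynomial Var ℂ} {d : ℤ × ℤ} (hP : Irreducible P)
    (hPd : P.IsWeightedHomogeneous (wt m) d) {s : Var} (hs : wt m s ≠ d) : ¬ P ∣ X s := by
  intro h
  obtain ⟨c, hc, hX⟩ := associated_iff_exists_smul.1
    (hP.associated_of_dvd (X_prime (i := s)).irreducible h)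
  have h1 := hPd.C_mul c
  rw [C_mul', ← hX] at h1
  exact hs (IsWeightedHomogeneous.inj_right (X_ne_zero s) (isWeightedHomogeneous_X ℂ (wt m) s) h1)

/-- An irreducible form of degree `(a, 0)` is neither `x₁` nor `y₁`, so its zero set meets the
affine plane and its equation there is irreducible. -/
lemma irreducible_of_isDivisorOf {a m : ℕ} (ha : 1 ≤ a) (hm : 1 ≤ m)
    {F : MvPolynomial (Fin 2) ℂ} {D : Divisor m} (hD : IsIrreducibleDivisor D)
    (hF : IsDivisorOf a F D) : Irreducible F := by
  obtain ⟨Z, rfl⟩ := hD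
  obtain ⟨G, hG, rfl, h⟩ := (isDivisorOf_iff ha hm).1 hF
  rw [← Z.div_eqn] at h
  have hirr : Irreducible G.1 := (Form.associated_iff.2 h).symm.irreducible Z.irreducible_eqn
  have hmeet : MeetsChart G.1 1 1 := by
    constructor
    · refine not_dvd_X_of_degree hirr hG fun hc => ?_
      simp [wt] at hc
      omega
    · refine not_dvd_X_of_degree hirr hG fun hc => ?_
      simp [wt] at hc
  exact (hmeet.prime_dehom hirr hG).irreducible

/-! ### The conditions for bidegree `(a, am - r)` -/

lemma hasBidegree_smul_iff {c : ℂ} (hc : c ≠ 0) (F : MvPolynomial (Fin 2) ℂ) (a b : ℕ) :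
    HasBidegree (c • F) a b ↔ HasBidegree F a b := by
  rw [HasBidegree, HasBidegree, newtonPolygon, newtonPolygon, support_smul_eq hc, ne_eq, ne_eq,
    smul_eq_zero_iff_right hc]

lemma hasBidegree_iff_forall_pow_dvd {a m r : ℕ} (hm : 1 ≤ m) (hr : r < a)
    {F : MvPolynomial (Fin 2) ℂ} {D : Divisor m} (hF : IsDivisorOf a F D)
    {g : ℕ → MvPolynomial (Fin 2) ℂ} (hg : IsZeroDivisorOf a g D) :
    HasBidegree F a (a * m - r) ↔
      ∀ i ≤ a, (X 1 : MvPolynomial (Fin 2) ℂ) ^ (r - i * r / a) ∣ g i := by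
  obtain ⟨hgh, G, hGg, rfl⟩ := hg
  have hG := isWeightedHomogeneous_formSum hgh
  rw [← hGg] at hG
  obtain ⟨c, hc, rfl⟩ := (isDivisorOf_dehom_div_iff (by omega) hm hG F).1 hF
  rw [hasBidegree_smul_iff hc, hasBidegree_mul_iff hm hr, and_iff_right (G.dehom_ne_zero 1 1),
    hGg, forall_coeff_dehom_formSum_iff hgh fun i => r - i * r / a]

lemma forall_pow_dvd_iff_forall_coeff_dehom {a m : ℕ} {g : ℕ → MvPolynomial (Fin 2) ℂ}
    (hg : ∀ i ≤ a, (g i).IsHomogeneous (m * (a - i))) (k : ℕ → ℕ) :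
    (∀ i ≤ a, (X 1 : MvPolynomial (Fin 2) ℂ) ^ k i ∣ g i) ↔
      ∀ e, coeff e (dehom 1 0 (formSum a g)) ≠ 0 → k (e 0) ≤ e 1 := by
  simp only [X_pow_dvd_iff_forall_coeff]
  constructor
  · intro h e he
    rw [coeff_dehom_formSum hg] at he
    split_ifs at he with hc
    · have := h (e 0) hc.1 _ he
      rwa [show expo 0 (e 1) (m * (a - e 0) - e 1) 1 = e 1 from expo_apply_sub 0 _ _] at this
    · exact absurd rfl he
  · intro h i hi d hd
    obtain ⟨hle, hexp⟩ := eq_expo_of_isHomogeneous (hg i hi) hd 0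
    have h1 := h (expo 1 i (d (1 - 0)))
    rw [coeff_dehom_formSum hg] at h1
    rw [show expo 1 i (d (1 - 0)) 0 = i from expo_apply_sub 1 _ _, expo_apply_same,
      if_pos ⟨hi, hle⟩, ← hexp] at h1
    exact h1 hd

/-- In the chart around `p`, the polynomial `F` is of bidegree `(a, am - r)` exactly if the Newton
polygon of the local equation of its divisor lies above the line through `(0, r)` and `(a, 0)`. -/
lemma exists_form_forall_hasBidegree_iff {a m : ℕ} (ha : 1 ≤ a) (hm : 1 ≤ m)
    {F : MvPolynomial (Fin 2) ℂ} {D : Divisor m} (hF : IsDivisorOf a F D) :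
    ∃ G : Form m, G.div = D ∧ (∀ i, a < i → coeff (expo 1 i 0) (dehom 1 0 G.1) = 0) ∧
      ∀ r < a, HasBidegree F a (a * m - r) ↔
        ∀ k l, coeff (expo 1 k l) (dehom 1 0 G.1) ≠ 0 → r - k * r / a ≤ l := by
  obtain ⟨G, hGg, hG, hGF⟩ := exists_homogenization ha hm hF.bidegree
  have hdiv : G.div = D := (existsUnique_isDivisorOf ha hm hF.bidegree).unique
    ((isDivisorOf_iff ha hm).2 ⟨G, hG, hGF, rfl⟩) hF
  have hhom : ∀ i ≤ a, (homogCoeff a m F i).IsHomogeneous (m * (a - i)) :=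
    fun i _ => isHomogeneous_homogCoeff a m F i
  refine ⟨G, hdiv, fun i hi => ?_, fun r hr => ?_⟩
  · rw [hGg, coeff_dehom_formSum hhom, if_neg]
    rw [show expo 1 i 0 0 = i from expo_apply_sub 1 _ _]
    omega
  · rw [hasBidegree_iff_forall_pow_dvd hm hr hF ⟨hhom, G, hGg, hdiv⟩,
      forall_pow_dvd_iff_forall_coeff_dehom hhom fun i => r - i * r / a, hGg]
    constructor
    · intro h k l hkl
      have := h _ hkl
      rwa [show expo 1 k l 0 = k from expo_apply_sub 1 _ _, expo_apply_same] at this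
    · intro h e he
      rw [show e = expo 1 (e 0) (e 1) from eq_expo 1 e] at he
      exact h _ _ he

lemma hasBidegree_one_iff {a m : ℕ} (ha : 1 < a) (hm : 1 ≤ m) {F : MvPolynomial (Fin 2) ℂ}
    {D : Divisor m} (hF : IsDivisorOf a F D) :
    HasBidegree F a (a * m - 1) ↔ interAt (fiber m) D (pointP m) = (a : ℕ∞) ∨
      IsComponent (Form.var m (Sum.inr 1)) D := by
  obtain ⟨G, rfl, hhigh, hiff⟩ := exists_form_forall_hasBidegree_iff ha.le hm hF
  rw [hiff 1 ha, interAt_fiber_div_pointP, isComponent_fiber_iff]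
  set f := dehom 1 0 G.1
  have h1 : (∀ k l, coeff (expo 1 k l) f ≠ 0 → 1 - k * 1 / a ≤ l) ↔
      ∀ k < a, coeff (expo 1 k 0) f = 0 := by
    constructor
    · intro h k hk
      by_contra hn
      have := h k 0 hn
      rw [mul_one, Nat.div_eq_of_lt hk] at this
      omega
    · intro h k l hkl
      rcases Nat.eq_zero_or_pos l with rfl | hl
      · have hk : a ≤ k := by
          by_contra hk
          exact hkl (h k (not_le.1 hk))
        have : 1 ≤ k * 1 / a := by
          rw [mul_one]
          exact Nat.div_pos hk (by omega)
        omega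
      · exact (Nat.sub_le _ _).trans hl
  rw [h1]
  by_cases hall : ∀ i, coeff (expo 1 i 0) f = 0
  · exact iff_of_true (fun i _ => hall i) (Or.inr hall)
  · simp only [hall, or_false]
    push Not at hall
    have hk := Nat.find_spec hall
    have hlt : ∀ i < Nat.find hall, coeff (expo 1 i 0) f = 0 :=
      fun i hi => not_not.1 (Nat.find_min hall hi)
    rw [planeInter_span_X_one hlt hk, Nat.cast_inj]
    constructor
    · intro h
      refine le_antisymm ?_ ?_
      · by_contra hn
        exact hk (hhigh _ (not_le.1 hn))
      · by_contra hn
        exact hk (h _ (not_le.1 hn))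
    · intro h k hka
      exact hlt k (by omega)

lemma forall_coeff_cubic_iff (f : MvPolynomial (Fin 2) ℂ) :
    (∀ k l, coeff (expo 1 k l) f ≠ 0 → 2 - k * 2 / 3 ≤ l) ↔
      coeff (expo 1 0 0) f = 0 ∧ coeff (expo 1 1 0) f = 0 ∧ coeff (expo 1 0 1) f = 0 ∧
        coeff (expo 1 2 0) f = 0 ∧ coeff (expo 1 1 1) f = 0 := by
  constructor
  · intro h
    have key : ∀ k l, l < 2 - k * 2 / 3 → coeff (expo 1 k l) f = 0 := fun k l hkl => by
      by_contra hn
      have := h k l hn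
      omega
    exact ⟨key 0 0 (by norm_num), key 1 0 (by norm_num), key 0 1 (by norm_num),
      key 2 0 (by norm_num), key 1 1 (by norm_num)⟩
  · rintro ⟨h00, h10, h01, h20, h11⟩ k l hkl
    by_contra hn
    obtain ⟨rfl, rfl⟩ | ⟨rfl, rfl⟩ | ⟨rfl, rfl⟩ | ⟨rfl, rfl⟩ | ⟨rfl, rfl⟩ :
      (k = 0 ∧ l = 0) ∨ (k = 1 ∧ l = 0) ∨ (k = 0 ∧ l = 1) ∨ (k = 2 ∧ l = 0) ∨
        (k = 1 ∧ l = 1) := by omega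
    all_goals contradiction

lemma hasBidegree_two_iff {m : ℕ} (hm : 1 ≤ m) {F : MvPolynomial (Fin 2) ℂ} {D : Divisor m}
    (hF : IsDivisorOf 3 F D) :
    (HasBidegree F 3 (3 * m - 2) ↔ 3 ≤ multAt D (pointP m) ∨
      (multAt D (pointP m) = 2 ∧ SameTangents D (fiber m) (pointP m))) ∧
    (¬ IsComponent (Form.var m (Sum.inr 1)) D →
      (HasBidegree F 3 (3 * m - 2) ↔ multAt D (pointP m) = 3 ∨
        (multAt D (pointP m) = 2 ∧ SameTangents D (fiber m) (pointP m)))) := by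
  obtain ⟨G, rfl, hhigh, hiff⟩ := exists_form_forall_hasBidegree_iff (by norm_num) hm hF
  rw [hiff 2 (by norm_num), forall_coeff_cubic_iff, isComponent_fiber_iff, multAt_div_pointP,
    sameTangents_div_fiber_pointP, mult_and_tangent_iff]
  refine ⟨Iff.rfl, fun hcomp => ?_⟩
  rw [← mult_and_tangent_iff]
  constructor
  · rintro h
    have hcoef := (mult_and_tangent_iff _).1 h
    rcases h with h | h
    · refine Or.inl (le_antisymm ?_ h)
      -- The local equation restricts to a nonzero multiple of `X 0 ^ 3` on the fiber.
      have h3 : coeff (expo 1 3 0) (dehom 1 0 G.1) ≠ 0 := by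
        intro h3
        refine hcomp fun i => ?_
        rcases Nat.lt_or_ge 3 i with hi | hi
        · exact hhigh i hi
        · interval_cases i
          exacts [hcoef.1, hcoef.2.1, hcoef.2.2.2.1, h3]
      by_contra hn
      replace hn := Order.add_one_le_of_lt (not_le.1 hn)
      exact h3 ((natCast_le_planeMult_iff _ 4).1 (by exact_mod_cast hn) _ (by simp [expo]))
    · exact Or.inr h
  · rintro (h | h)
    · exact Or.inl h.ge
    · exact Or.inr h

end HirzebruchSurface

end

theorem lemma3p2 (a m : ℕ) (ha : 1 ≤ a) (hm : 1 ≤ m) :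
    -- every polynomial of bidegree (a, am) has a unique (a, am)-divisor
    (∀ F : MvPolynomial (Fin 2) ℂ, HasBidegree F a (a * m) →
      ∃! D : Divisor m, IsDivisorOf a F D) ∧
    -- every effective divisor D ~ a S₊ comes from a polynomial, unique up to a constant
    (∀ D : Divisor m, 0 ≤ D → LinEquiv D (a • sPlus m) →
      (∃ F : MvPolynomial (Fin 2) ℂ, IsDivisorOf a F D ∧
        ∀ F' : MvPolynomial (Fin 2) ℂ, IsDivisorOf a F' D ↔ ∃ c : ℂ, c ≠ 0 ∧ F' = c • F) ∧
      (IsIrreducibleDivisor D →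
        ∀ F : MvPolynomial (Fin 2) ℂ, IsDivisorOf a F D → Irreducible F)) ∧
    -- the conditions for bidegree (a, am - r)
    (∀ (F : MvPolynomial (Fin 2) ℂ) (D : Divisor m), IsDivisorOf a F D →
      (∃ g : ℕ → MvPolynomial (Fin 2) ℂ, IsZeroDivisorOf a g D) ∧
      (∀ g : ℕ → MvPolynomial (Fin 2) ℂ, IsZeroDivisorOf a g D →
        ∀ r : ℕ, r < a →
          (HasBidegree F a (a * m - r) ↔
            ∀ i ≤ a, (X 1 : MvPolynomial (Fin 2) ℂ) ^ (r - i * r / a) ∣ g i)) ∧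
      (1 < a →
        (HasBidegree F a (a * m - 1) ↔
          interAt (fiber m) D (pointP m) = (a : ℕ∞) ∨
            IsComponent (Form.var m (Sum.inr 1)) D)) ∧
      (a = 3 →
        (HasBidegree F a (a * m - 2) ↔
          3 ≤ multAt D (pointP m) ∨
            (multAt D (pointP m) = 2 ∧ SameTangents D (fiber m) (pointP m))) ∧
        (¬ IsComponent (Form.var m (Sum.inr 1)) D →
          (HasBidegree F a (a * m - 2) ↔
            multAt D (pointP m) = 3 ∨
              (multAt D (pointP m) = 2 ∧ SameTangents D (fiber m) (pointP m)))))) := by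
  refine ⟨fun F hF => existsUnique_isDivisorOf ha hm hF, fun D hD hlin => ⟨?_, ?_⟩,
    fun F D hF => ⟨?_, ?_, ?_, ?_⟩⟩
  · obtain ⟨G, hG, rfl⟩ := exists_div_eq_of_linEquiv hD hlin
    exact ⟨dehom 1 1 G.1, (isDivisorOf_iff ha hm).2 ⟨G, hG, rfl, rfl⟩,
      isDivisorOf_dehom_div_iff ha hm hG⟩
  · exact fun hirr F hF => irreducible_of_isDivisorOf ha hm hirr hF
  · obtain ⟨G, hGg, hG, hGF⟩ := exists_homogenization ha hm hF.bidegree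
    exact ⟨homogCoeff a m F, fun i _ => isHomogeneous_homogCoeff a m F i, G, hGg,
      (existsUnique_isDivisorOf ha hm hF.bidegree).unique
        ((isDivisorOf_iff ha hm).2 ⟨G, hG, hGF, rfl⟩) hF⟩
  · exact fun g hg r hr => hasBidegree_iff_forall_pow_dvd hm hr hF hg
  · exact fun ha1 => hasBidegree_one_iff ha1 hm hF
  · rintro rfl
    exact hasBidegree_two_iff hm hF
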